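/- Let $d\ge 1$, let $D_d\subset\mathbb{R}^d$ be bounded, let $\mathcal{I}_d\subset (D_d)^{\mathbb{Z}_-}$ be a set of input sequences $\mathbf z=(\mathbf z_t)_{t\in\mathbb{Z}_-}$, $\mathbb{Z}_-=\{0,-1,-2,\dots\}$, with the $\sigma$-algebra induced by the product Borel $\sigma$-algebra, and let $\sigma_2\colon\mathbb{R}\to\mathbb{R}$ be either $\sigma_2(x)=\max(x,0)$ or a bounded, Lipschitz-continuous, non-constant function. For every $N\ge 1$ let $A_N\in\mathbb{R}^{N\times N}$, $\mathbf B_N\in\mathbb{R}^N$, $C_N\in\mathbb{R}^{N\times d}$ be the parameters of a linear echo state network (ESN) $$\mathbf x_t=A_N\mathbf x_{t-1}+C_N\mathbf z_t+\mathbf B_N,\qquad t\in\mathbb{Z}_-,$$ and let $K_N\in\mathbb{R}^{N\times N}$ consist of the first $N$ columns of $(C_N\,|\,A_NC_N\,|\,A_N^2C_N\,|\cdots)$. Write $\|\cdot\|$ for Euclidean norms and $|||\cdot|||$ for the induced operator norms. Assume that there are $\bar c>0$ and $0<\underline l<\bar l<1$ such that for every $N\ge1$ the matrix $K_N$ is invertible,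 $\underline l<|||A_N|||<\bar l$, $\|\mathbf B_N\|\le\bar c$, $|||C_N|||\le\bar c$ and $|||K_N^{-\top}\Lambda_N|||\le\bar c$, where $\Lambda_N\in\mathbb{R}^{N\times N}$ is the diagonal matrix with entries $(\Lambda_N)_{d(k-1)+j,\,d(k-1)+j}=\underline l^{\,k-1}$ for $k\ge1$, $1\le j\le d$, $d(k-1)+j\le N$. For every $N\ge1$ let $\nu_0^N$ be a prescribed probability measure on the space $\mathcal{X}^N=\mathbb{R}\times\mathbb{R}^N\times\mathbb{R}^d\times\mathbb{R}$ of hidden weights $(w,\mathbf a,\mathbf c,b)$, with first moments bounded uniformly in $N$: $\sup_{N}\int_{\mathcal{X}^N}\|x\|\,\nu_0^N(dx)<\infty$. Let $\gamma$ be a probability measure on $\mathcal{I}_d$, let $H\in L^2(\mathcal{I}_d,\gamma)$ be real-valued and let $\varepsilon>0$. Then there is $N_0$ such that for every $N\ge N_0$ the following holds. For each $\mathbf z\in\mathcal{I}_d$ the ESN has a unique bounded solution $(\mathbf x_t(\mathbf z))_{t\in\mathbb{Z}_-}$, and there are a probability measure $\nu$ on $\mathcal{X}^N$ with $\mathcal{W}_1(\nu_0^N,\nu)<\varepsilon$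 ($\mathcal{W}_1$ being the 1-Wasserstein distance for the Euclidean distance on $\mathcal{X}^N$) and a measurable map $f\colon(\mathcal{X}^N)^N\to\mathbb{R}^N$ such that, if $(w^{(i)},\mathbf a^{(i)},\mathbf c^{(i)},b_i)$, $i=1,\dots,N$, are i.i.d. with law $\nu$ and $\mathbf W=f\big((w^{(i)},\mathbf a^{(i)},\mathbf c^{(i)},b_i)_{i=1,\dots,N}\big)$, the ESN-ELM $$\widehat H(\mathbf z)=\sum_{i=1}^N W_i\,\sigma_2\big(\mathbf a^{(i)}\cdot\mathbf x_{-1}(\mathbf z)+\mathbf c^{(i)}\cdot\mathbf z_0+b_i\big)$$ satisfies $$\Big(\int_{\mathcal{I}_d}\mathbb{E}\big[|H(\mathbf z)-\widehat H(\mathbf z)|^2\big]\,\gamma(d\mathbf z)\Big)^{1/2}<\varepsilon.$$ -/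

import Mathlib

open MeasureTheory
open scoped ENNReal NNReal Matrix.Norms.L2Operator

noncomputable section

namespace ESN

/-- `ℝⁿ` with the Euclidean norm. -/
abbrev Vec (n : ℕ) : Type := EuclideanSpace ℝ (Fin n)

/-- Semi-infinite sequences `(u_t)` indexed by the non-positive integers `t = 0, -1, -2, …`;
the entry `u k` stands for `u_{-k}`. -/
abbrev PastSeq (n : ℕ) : Type := ℕ → Vec n

/-- The space `ℝ × ℝᴺ × ℝᵈ × ℝ` of hidden weights `(w, a, c, b)`. -/
abbrev Weights (N d : ℕ) : Type := ℝ × Vec N × Vec d × ℝ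

/-- The Euclidean norm on `ℝ × ℝᴺ × ℝᵈ × ℝ` (the norm that Lean puts on a product is the
maximum norm, which is not used here). -/
def weightNorm {N d : ℕ} (x : Weights N d) : ℝ :=
  √(x.1 ^ 2 + ‖x.2.1‖ ^ 2 + ‖x.2.2.1‖ ^ 2 + x.2.2.2 ^ 2)

/-- First absolute moment. -/
def firstMoment {N d : ℕ} (ν : Measure (Weights N d)) : ℝ≥0∞ :=
  ∫⁻ x, ENNReal.ofReal (weightNorm x) ∂ν

/-- `π` is a coupling of `μ` and `ν`. -/
def IsCoupling {N d : ℕ} (π : Measure (Weights N d × Weights N d))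
    (μ ν : Measure (Weights N d)) : Prop :=
  π.map Prod.fst = μ ∧ π.map Prod.snd = ν

/-- The 1-Wasserstein distance with respect to the Euclidean distance: the infimum of the
transport cost over all couplings. -/
def wasserstein1 {N d : ℕ} (μ ν : Measure (Weights N d)) : ℝ≥0∞ :=
  ⨅ (π : Measure (Weights N d × Weights N d)) (_ : IsCoupling π μ ν),
    ∫⁻ p, ENNReal.ofReal (weightNorm (p.1 - p.2)) ∂π

/-- `x` is a bounded solution of `x_t = σ₁(A x_{t-1} + C z_t + B)`, `t = 0, -1, -2, …`, where `σ₁`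
acts componentwise. -/
def IsBoundedSolution {N d : ℕ} (σ₁ : ℝ → ℝ) (A : Matrix (Fin N) (Fin N) ℝ) (B : Vec N)
    (C : Matrix (Fin N) (Fin d) ℝ) (z : PastSeq d) (x : PastSeq N) : Prop :=
  (∀ k i, x k i = σ₁ (A.mulVec (x (k + 1)) i + C.mulVec (z k) i + B i)) ∧
    ∃ R : ℝ, ∀ k, ‖x k‖ ≤ R

/-- The state sequence of the echo state network with input `z`: the bounded solution of the state
equation (an unspecified sequence if there is none). -/
def state {N d : ℕ} (σ₁ : ℝ → ℝ) (A : Matrix (Fin N) (Fin N) ℝ) (B : Vec N)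
    (C : Matrix (Fin N) (Fin d) ℝ) (z : PastSeq d) : PastSeq N :=
  Classical.epsilon (IsBoundedSolution σ₁ A B C z)

/-- The ESN-ELM with readout `W` and hidden weights `ξ i = (w⁽ⁱ⁾, a⁽ⁱ⁾, c⁽ⁱ⁾, b_i)`:
`z ↦ ∑ i, W_i σ₂(a⁽ⁱ⁾ · x_{-1}(z) + c⁽ⁱ⁾ · z_0 + b_i)`. -/
def esnElm {N d : ℕ} (σ₁ σ₂ : ℝ → ℝ) (A : Matrix (Fin N) (Fin N) ℝ) (B : Vec N)
    (C : Matrix (Fin N) (Fin d) ℝ) (W : Fin N → ℝ) (ξ : Fin N → Weights N d)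
    (z : PastSeq d) : ℝ :=
  ∑ i, W i * σ₂ (inner ℝ (ξ i).2.1 (state σ₁ A B C z 1) + inner ℝ (ξ i).2.2.1 (z 0) + (ξ i).2.2.2)

/-- The controllability matrix: the first `N` columns of `(C | A C | A² C | ⋯)`. With columns
numbered from `0`, column `d k + j` (`0 ≤ j < d`) is column `j` of `Aᵏ C`. -/
def controllability {N d : ℕ} [NeZero d] (A : Matrix (Fin N) (Fin N) ℝ)
    (C : Matrix (Fin N) (Fin d) ℝ) : Matrix (Fin N) (Fin N) ℝ :=
  Matrix.of fun i m => (A ^ ((m : ℕ) / d) * C) i (Fin.ofNat d (m : ℕ))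

/-- The diagonal matrix whose entry at position `d k + j` (`0 ≤ j < d`, numbered from `0`)
is `lᵏ`. -/
def decay (N d : ℕ) (l : ℝ) : Matrix (Fin N) (Fin N) ℝ :=
  Matrix.diagonal fun m => l ^ ((m : ℕ) / d)

end ESN

end

/-! The proof combines a density theorem in `L²(γ)`, a reading of the past off the state, and a
small perturbation of the sampling law. Density (`exists_network_approx`): suppose `φ` is orthogonal
to every neuron `σ₂(t + b)`, where `t` is a linear functional of finitely many past inputs.
Replacing `σ₂` by a combination of two translates makes it bounded and non-constant (for the
rectifier, a ramp), and mollifying gives a smooth `g` with `∫ g(s t + b) φ = 0` for all `s` and `b`.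
Differentiating `n` times in `s` at `s = 0` gives `g⁽ⁿ⁾(b) ∫ tⁿ φ = 0`. A bounded non-constant `g`
is not a polynomial, so some `g⁽ⁿ⁾(b) ≠ 0` and all moments `∫ tⁿ φ` vanish. As `t` is bounded, `∫
exp(i t) φ = 0`, and uniqueness of characteristic functions gives `φ = 0`. Reading the state
(`exists_state_weight`): unrolling the recursion writes `x_{-1}` as a sum of `Aʲ(C z_{-1-j} + B)`
over `j < N / d`, plus a remainder of order `l₁^(N/d)`. Applying `K⁻ᵀ` to the coefficients of a
functional gives a state weight that recovers it. The bound on `K⁻ᵀ Λ` keeps this weight bounded in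
`N`, because only finitely many coefficients are nonzero. Sampling: the finitely many weights so
obtained get total mass `δ` in the mixture `ν = (1 - δ) ν₀ + δ · (uniform)`, which costs `O(δ)` in
`W₁`. Each becomes an atom of mass bounded below in `N`, so `N` samples hit all of them with
probability tending to `1`. Then the readout reproduces the network exactly; otherwise it is set to
`0`. -/

noncomputable section

namespace ESN

/-! ### Moments and characters annihilated by a density orthogonal to ridge functions. -/

section Density

open Filter Topology
open scoped ContDiff Convolution

/-- Every real polynomial has an antiderivative. -/
theorem exists_derivative_eq (p : Polynomial ℝ) : ∃ q : Polynomial ℝ, q.derivative = p := by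
  induction p using Polynomial.induction_on' with
  | add p q hp hq =>
    obtain ⟨p', rfl⟩ := hp
    obtain ⟨q', rfl⟩ := hq
    exact ⟨p' + q', by simp⟩
  | monomial n a =>
    refine ⟨Polynomial.monomial (n + 1) (a / (n + 1)), ?_⟩
    rw [Polynomial.derivative_monomial]
    have : (n : ℝ) + 1 ≠ 0 := by positivity
    congr 1
    push_cast
    field_simp

/-- A smooth function with a vanishing iterated derivative is a polynomial. -/
theorem exists_polynomial_of_iteratedDeriv_eq_zero (n : ℕ) :
    ∀ g : ℝ → ℝ, ContDiff ℝ ∞ g → (∀ x, iteratedDeriv n g x = 0) →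
      ∃ p : Polynomial ℝ, ∀ x, g x = p.eval x := by
  induction n with
  | zero => exact fun g _ h => ⟨0, fun x => by simpa using h x⟩
  | succ n ih =>
    intro g hg h
    have hg' : ContDiff ℝ ∞ (deriv g) := (contDiff_infty_iff_deriv.1 hg).2
    obtain ⟨p, hp⟩ := ih (deriv g) hg' fun x => by rw [← iteratedDeriv_succ']; exact h x
    obtain ⟨q, rfl⟩ := exists_derivative_eq p
    have hd : Differentiable ℝ g := hg.differentiable (by simp)
    have hc := is_const_of_deriv_eq_zero (f := fun x => g x - q.eval x)
      (hd.sub q.differentiable) fun x => by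
        rw [deriv_fun_sub (hd x) q.differentiableAt, hp x, Polynomial.deriv, sub_self]
    refine ⟨q + Polynomial.C (g 0 - q.eval 0), fun x => ?_⟩
    have := hc x 0
    simp only [Polynomial.eval_add, Polynomial.eval_C]
    linarith

/-- A bounded non-constant smooth function has no identically vanishing iterated derivative. -/
theorem exists_iteratedDeriv_ne_zero {g : ℝ → ℝ} (hg : ContDiff ℝ ∞ g) {R : ℝ}
    (hR : ∀ x, |g x| ≤ R) {x y : ℝ} (hxy : g x ≠ g y) (n : ℕ) : ∃ b, iteratedDeriv n g b ≠ 0 := by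
  by_contra! h
  obtain ⟨p, hp⟩ := exists_polynomial_of_iteratedDeriv_eq_zero n g hg h
  have hdeg : p.degree ≤ 0 := by
    rw [← Polynomial.isBoundedUnder_abs_atTop_iff]
    exact ⟨R, eventually_map.2 (Eventually.of_forall fun x => by simpa only [hp] using hR x)⟩
  apply hxy
  rw [hp, hp, Polynomial.eq_C_of_degree_le_zero hdeg, Polynomial.eval_C, Polynomial.eval_C]

/-- A bounded continuous non-constant function has a smooth, bounded and non-constant
mollification. -/
theorem exists_mollification {σ : ℝ → ℝ} (hσ : Continuous σ) {R : ℝ} (hR : ∀ x, |σ x| ≤ R)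
    {x₀ y₀ : ℝ} (hne : σ x₀ ≠ σ y₀) :
    ∃ ψ : ℝ → ℝ, Integrable ψ ∧ ContDiff ℝ ∞ (fun x => ∫ y, ψ y * σ (x - y)) ∧
      (∀ x, |∫ y, ψ y * σ (x - y)| ≤ R) ∧
      ∫ y, ψ y * σ (x₀ - y) ≠ ∫ y, ψ y * σ (y₀ - y) := by
  -- Each mollified value lies within `e` of the original one, so equal values would force `3e ≤
  -- 2e`.
  set e := |σ x₀ - σ y₀| / 3 with he
  have hpos : 0 < |σ x₀ - σ y₀| := abs_pos.2 (sub_ne_zero.2 hne)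
  have hepos : 0 < e := by positivity
  obtain ⟨r₁, hr₁, h₁⟩ := Metric.continuous_iff.1 hσ x₀ e hepos
  obtain ⟨r₂, hr₂, h₂⟩ := Metric.continuous_iff.1 hσ y₀ e hepos
  have hr : 0 < min r₁ r₂ := lt_min hr₁ hr₂
  let φ : ContDiffBump (0 : ℝ) := ⟨min r₁ r₂ / 2, min r₁ r₂, by positivity, by linarith⟩
  have hconv : ∀ x, (φ.normed volume ⋆[ContinuousLinearMap.lsmul ℝ ℝ, volume] σ) x =
      ∫ y, φ.normed volume y * σ (x - y) := fun x => rfl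
  have hψ : Integrable (φ.normed volume) := φ.integrable_normed
  refine ⟨φ.normed volume, hψ, ?_, ?_, ?_⟩
  · exact HasCompactSupport.contDiff_convolution_left (n := ⊤)
      (ContinuousLinearMap.lsmul ℝ ℝ) φ.hasCompactSupport_normed φ.contDiff_normed
      hσ.locallyIntegrable
  · intro x
    calc |∫ y, φ.normed volume y * σ (x - y)| ≤ ∫ y, φ.normed volume y * R := by
          rw [← Real.norm_eq_abs]
          refine norm_integral_le_of_norm_le (hψ.mul_const R) (Eventually.of_forall fun y => ?_)
          rw [norm_mul, Real.norm_of_nonneg (φ.nonneg_normed y)]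
          exact mul_le_mul_of_nonneg_left (hR _) (φ.nonneg_normed y)
      _ = R := by rw [integral_mul_const, φ.integral_normed, one_mul]
  · have b₁ := φ.dist_normed_convolution_le (μ := volume) (g := σ) (x₀ := x₀) (ε := e)
      hσ.aestronglyMeasurable fun x hx =>
        (h₁ x (lt_of_lt_of_le (Metric.mem_ball.1 hx) (min_le_left _ _))).le
    have b₂ := φ.dist_normed_convolution_le (μ := volume) (g := σ) (x₀ := y₀) (ε := e)
      hσ.aestronglyMeasurable fun x hx =>
        (h₂ x (lt_of_lt_of_le (Metric.mem_ball.1 hx) (min_le_right _ _))).le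
    rw [hconv, Real.dist_eq] at b₁ b₂
    intro heq
    rw [heq] at b₁
    have : |σ x₀ - σ y₀| ≤ e + e := by
      have := abs_sub_le (σ x₀) (∫ y, φ.normed volume y * σ (y₀ - y)) (σ y₀)
      rw [abs_sub_comm] at b₁
      linarith
    linarith

variable {Ω : Type*} [MeasurableSpace Ω] {γ : Measure Ω}

/-- If a density `φ` annihilates all dilations and translations of a smooth function of a bounded
random variable `t`, then differentiating in the dilation shows that it annihilates
`tⁿ g⁽ⁿ⁾(s t + b)`. -/
theorem integral_pow_mul_iteratedDeriv_eq_zero {g : ℝ → ℝ} (hg : ContDiff ℝ ∞ g) {φ : Ω → ℝ}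
    (hφ : Integrable φ γ) {t : Ω → ℝ} (ht : Measurable t) {R : ℝ} (hR : ∀ z, |t z| ≤ R)
    (h : ∀ s b, ∫ z, g (s * t z + b) * φ z ∂γ = 0) (n : ℕ) :
    ∀ s b, ∫ z, t z ^ n * iteratedDeriv n g (s * t z + b) * φ z ∂γ = 0 := by
  induction n with
  | zero => simpa using h
  | succ n ih =>
    intro s b
    have hcont : ∀ k, Continuous (iteratedDeriv k g) := fun k =>
      hg.continuous_iteratedDeriv k (by exact_mod_cast le_top)
    -- `R` may be negative when `Ω` is empty.
    obtain ⟨R', hR0, hRR⟩ : ∃ R', 0 ≤ R' ∧ ∀ z, |t z| ≤ R' :=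
      ⟨|R|, abs_nonneg R, fun z => (hR z).trans (le_abs_self R)⟩
    have hbd : ∀ k, ∃ K, ∀ s' ∈ Metric.ball s 1, ∀ z, |iteratedDeriv k g (s' * t z + b)| ≤ K := by
      intro k
      obtain ⟨K, hK⟩ := (isCompact_closedBall (0 : ℝ)
        ((|s| + 1) * R' + |b|)).exists_bound_of_continuousOn (hcont k).continuousOn
      refine ⟨K, fun s' hs' z => hK _ ?_⟩
      rw [mem_closedBall_zero_iff, Real.norm_eq_abs]
      have hs'' : |s'| ≤ |s| + 1 := by
        have h1 : |s' - s| < 1 := by simpa [Real.dist_eq] using hs'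
        have := abs_sub_abs_le_abs_sub s' s
        linarith
      calc |s' * t z + b| ≤ |s'| * |t z| + |b| := by rw [← abs_mul]; exact abs_add_le _ _
        _ ≤ _ := by gcongr; exact hRR z
    have hmeas : ∀ k m s', AEStronglyMeasurable
        (fun z => t z ^ m * iteratedDeriv k g (s' * t z + b) * φ z) γ := fun k m s' =>
      ((ht.pow_const m).mul ((hcont k).measurable.comp
        ((ht.const_mul s').add_const b))).aestronglyMeasurable.mul hφ.1
    have hbound : ∀ k m, ∃ K, ∀ s' ∈ Metric.ball s 1, ∀ z,
        ‖t z ^ m * iteratedDeriv k g (s' * t z + b) * φ z‖ ≤ K * |φ z| := by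
      intro k m
      obtain ⟨K, hK⟩ := hbd k
      refine ⟨R' ^ m * K, fun s' hs' z => ?_⟩
      rw [norm_mul, norm_mul, norm_pow, Real.norm_eq_abs, Real.norm_eq_abs, Real.norm_eq_abs]
      gcongr
      · exact hRR z
      · exact hK s' hs' z
    obtain ⟨K₀, hK₀⟩ := hbound n n
    obtain ⟨K₁, hK₁⟩ := hbound (n + 1) (n + 1)
    have hder := (hasDerivAt_integral_of_dominated_loc_of_deriv_le (μ := γ) (x₀ := s)
      (F := fun s' z => t z ^ n * iteratedDeriv n g (s' * t z + b) * φ z)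
      (F' := fun s' z => t z ^ (n + 1) * iteratedDeriv (n + 1) g (s' * t z + b) * φ z)
      (bound := fun z => K₁ * |φ z|) (Metric.ball_mem_nhds s one_pos)
      (Eventually.of_forall fun s' => hmeas n n s')
      ((hφ.abs.const_mul K₀).mono' (hmeas n n s)
        (Eventually.of_forall fun z => hK₀ s (Metric.mem_ball_self one_pos) z))
      (hmeas _ _ s) (Eventually.of_forall fun z s' hs' => hK₁ s' hs' z)
      (hφ.abs.const_mul K₁) (Eventually.of_forall fun z s' _ => ?_)).2
    · have : (fun s' => ∫ z, t z ^ n * iteratedDeriv n g (s' * t z + b) * φ z ∂γ) = fun _ => 0 :=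
        funext fun s' => ih s' b
      rw [this] at hder
      exact hder.unique (hasDerivAt_const s 0)
    · have h1 : HasDerivAt (iteratedDeriv n g) (iteratedDeriv (n + 1) g (s' * t z + b))
          (s' * t z + b) := by
        rw [iteratedDeriv_succ]
        exact (hg.differentiable_iteratedDeriv n (by exact_mod_cast ENat.natCast_lt_top n) _).hasDerivAt
      have h2 : HasDerivAt (fun s' => s' * t z + b) (t z) s' := by
        simpa using ((hasDerivAt_id s').mul_const (t z)).add_const b
      have := ((h1.comp s' h2).const_mul (t z ^ n)).mul_const (φ z)
      exact this.congr_deriv (by ring)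

/-- If a density annihilates all `σ(s t + b)` for a bounded continuous non-constant `σ`, then it
annihilates all powers of the bounded random variable `t`. -/
theorem integral_pow_mul_eq_zero [SFinite γ] {σ : ℝ → ℝ} (hσ : Continuous σ) {R : ℝ}
    (hR : ∀ x, |σ x| ≤ R) {x₀ y₀ : ℝ} (hne : σ x₀ ≠ σ y₀) {φ : Ω → ℝ} (hφ : Integrable φ γ)
    {t : Ω → ℝ} (ht : Measurable t) {S : ℝ} (hS : ∀ z, |t z| ≤ S)
    (h : ∀ s b, ∫ z, σ (s * t z + b) * φ z ∂γ = 0) (n : ℕ) : ∫ z, t z ^ n * φ z ∂γ = 0 := by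
  obtain ⟨ψ, hψ, hsmooth, hbdd, hne'⟩ := exists_mollification hσ hR hne
  obtain ⟨b, hb⟩ := exists_iteratedDeriv_ne_zero hsmooth hbdd hne' n
  -- At dilation `s = 0` the derivative factor is a constant, nonzero by the choice of `b`, and only
  -- the moment remains.
  have key := integral_pow_mul_iteratedDeriv_eq_zero hsmooth hφ ht hS (fun s b => ?_) n 0 b
  · simp only [zero_mul, zero_add] at key
    simp_rw [mul_right_comm _ (iteratedDeriv n _ b)] at key
    rw [integral_mul_const] at key
    exact (mul_eq_zero.1 key).resolve_right hb
  -- The mollification averages translates of `σ`, so by Fubini it is annihilated as well.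
  · have hint : Integrable (fun p : Ω × ℝ => ψ p.2 * σ (s * t p.1 + b - p.2) * φ p.1)
        (γ.prod volume) := by
      have h1 : Integrable (fun p : Ω × ℝ => φ p.1 * ψ p.2) (γ.prod volume) := hφ.mul_prod hψ
      have h2 : AEStronglyMeasurable (fun p : Ω × ℝ => σ (s * t p.1 + b - p.2))
          (γ.prod volume) :=
        (hσ.measurable.comp ((((ht.comp measurable_fst).const_mul s).add_const b).sub
          measurable_snd)).aestronglyMeasurable
      refine (h1.bdd_mul (c := R) h2 (Eventually.of_forall fun p => hR _)).congr
        (Eventually.of_forall fun p => ?_)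
      simp only
      ring
    calc ∫ z, (∫ y, ψ y * σ (s * t z + b - y)) * φ z ∂γ
        = ∫ z, (∫ y, ψ y * σ (s * t z + b - y) * φ z) ∂γ := by simp_rw [integral_mul_const]
      _ = ∫ y, (∫ z, ψ y * σ (s * t z + b - y) * φ z ∂γ) := integral_integral_swap hint
      _ = ∫ y, ψ y * ∫ z, σ (s * t z + (b - y)) * φ z ∂γ := by
        simp_rw [← integral_const_mul, mul_assoc, add_sub_assoc]
      _ = 0 := by simp [h]

/-- A density that annihilates all powers of a bounded random variable annihilates its
characters. -/
theorem integral_cexp_mul_eq_zero {φ : Ω → ℝ} (hφ : Integrable φ γ) {t : Ω → ℝ}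
    (ht : Measurable t) {S : ℝ} (hS : ∀ z, |t z| ≤ S) (h : ∀ n : ℕ, ∫ z, t z ^ n * φ z ∂γ = 0) :
    ∫ z, Complex.exp (t z * Complex.I) * φ z ∂γ = 0 := by
  obtain ⟨S', hS0, hSS⟩ : ∃ S', 0 ≤ S' ∧ ∀ z, |t z| ≤ S' :=
    ⟨|S|, abs_nonneg S, fun z => (hS z).trans (le_abs_self S)⟩
  -- Terms of the exponential series of `i t`, times `φ`; boundedness of `t` allows termwise
  -- integration.
  let F : ℕ → Ω → ℂ := fun n z => (Complex.I ^ n / n.factorial) * ((t z ^ n * φ z : ℝ) : ℂ)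
  have hint : ∀ n, Integrable (fun z => t z ^ n * φ z) γ := fun n =>
    hφ.bdd_mul (c := S' ^ n) (ht.pow_const n).aestronglyMeasurable
      (Eventually.of_forall fun z => by
        rw [norm_pow, Real.norm_eq_abs]
        exact pow_le_pow_left₀ (abs_nonneg _) (hSS z) n)
  have hF : ∀ n, Integrable (F n) γ := fun n => (hint n).ofReal.const_mul _
  have hnorm : ∀ n z, ‖F n z‖ ≤ S' ^ n / n.factorial * |φ z| := by
    intro n z
    simp only [F, norm_mul, norm_div, norm_pow, Complex.norm_I, one_pow, Complex.norm_real,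
      Complex.norm_natCast, Real.norm_eq_abs]
    rw [div_mul_eq_mul_div, div_mul_eq_mul_div, one_mul]
    gcongr
    exact hSS z
  have hsum : Summable fun n => ∫ z, ‖F n z‖ ∂γ := by
    refine Summable.of_nonneg_of_le (fun n => integral_nonneg fun z => norm_nonneg _)
      (fun n => ?_) ((Real.summable_pow_div_factorial S').mul_right (∫ z, |φ z| ∂γ))
    rw [← integral_const_mul]
    exact integral_mono (hF n).norm (hφ.abs.const_mul _) (hnorm n)
  have key := hasSum_integral_of_summable_integral_norm hF hsum
  have hz : ∀ n, ∫ z, F n z ∂γ = 0 := fun n => by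
    simp only [F]
    rw [integral_const_mul, integral_complex_ofReal, h n]
    simp
  simp_rw [hz] at key
  have htsum : ∀ z, ∑' n, F n z = Complex.exp (t z * Complex.I) * φ z := by
    intro z
    rw [Complex.exp_eq_exp_ℂ, NormedSpace.exp_eq_tsum_div, ← tsum_mul_right]
    congr 1
    ext n
    simp only [F]
    push_cast
    ring
  simp_rw [htsum] at key
  exact key.unique hasSum_zero

end Density

/-! ### Density of finite networks on input sequences in `L²`. -/

section Universality

open Filter Topology

/-- The linear functional `z ↦ ∑ k, θ_k · z_{-k}` of finitely many past inputs. -/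
def pastForm {d : ℕ} (θ : ℕ →₀ Vec d) (z : PastSeq d) : ℝ :=
  θ.sum fun k u => inner ℝ u (z k)

variable {d : ℕ}

theorem continuous_pastForm (θ : ℕ →₀ Vec d) : Continuous (pastForm θ) := by
  unfold pastForm Finsupp.sum
  fun_prop

theorem abs_pastForm_le (θ : ℕ →₀ Vec d) {R : ℝ} {z : PastSeq d} (hz : ∀ k, ‖z k‖ ≤ R) :
    |pastForm θ z| ≤ θ.sum fun _ u => ‖u‖ * R := by
  unfold pastForm Finsupp.sum
  refine (Finset.abs_sum_le_sum_abs _ _).trans (Finset.sum_le_sum fun k _ => ?_)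
  exact (abs_real_inner_le_norm _ _).trans (mul_le_mul_of_nonneg_left (hz k) (norm_nonneg _))

/-- `pastForm` as a bilinear pairing. -/
def pastPairing (d : ℕ) : PastSeq d →ₗ[ℝ] (ℕ →₀ Vec d) →ₗ[ℝ] ℝ :=
  LinearMap.mk₂ ℝ (fun z θ => pastForm θ z)
    (fun z z' θ => by simp [pastForm, Finsupp.sum, inner_add_right, Finset.sum_add_distrib])
    (fun a z θ => by simp [pastForm, Finsupp.sum, inner_smul_right, Finset.mul_sum])
    (fun z θ θ' => Finsupp.sum_add_index' (by simp) (by simp [inner_add_left]))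
    (fun a z θ => by
      unfold pastForm
      rw [Finsupp.sum_smul_index' (by simp)]
      simp [Finsupp.sum, inner_smul_left, Finset.mul_sum])

@[simp]
theorem pastPairing_apply (z : PastSeq d) (θ : ℕ →₀ Vec d) :
    pastPairing d z θ = pastForm θ z := rfl

theorem pastForm_smul (s : ℝ) (θ : ℕ →₀ Vec d) (z : PastSeq d) :
    pastForm (s • θ) z = s * pastForm θ z :=
  ((pastPairing d) z).map_smul s θ

/-- Finite measures on sequences are determined by their characteristic functions. -/
theorem ext_of_integral_cexp_pastForm {P P' : Measure (PastSeq d)} [IsFiniteMeasure P]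
    [IsFiniteMeasure P']
    (h : ∀ θ : ℕ →₀ Vec d, ∫ z, Complex.exp (pastForm θ z * Complex.I) ∂P =
      ∫ z, Complex.exp (pastForm θ z * Complex.I) ∂P') : P = P' := by
  -- With the discrete topology on functionals, joint continuity of the pairing reduces to
  -- continuity in `z`.
  let : TopologicalSpace (ℕ →₀ Vec d) := ⊥
  have : DiscreteTopology (ℕ →₀ Vec d) := ⟨rfl⟩
  let := TopologicalSpace.upgradeIsCompletelyMetrizable (PastSeq d)
  refine ext_of_integral_char_eq (L := pastPairing d) Real.continuous_probChar
    Real.probChar_ne_one (fun v hv => ?_) ?_ fun θ => ?_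
  · obtain ⟨k, hk⟩ := Function.ne_iff.1 hv
    refine DFunLike.ne_iff.2 ⟨Finsupp.single k (v k), ?_⟩
    simpa [pastForm] using hk
  · exact continuous_prod_of_discrete_right.2 fun θ => continuous_pastForm θ
  · simpa [BoundedContinuousFunction.char_apply, Real.probChar_apply] using h θ

variable {I : Set (PastSeq d)} {γ : Measure I}

/-- A density on a set of sequences is zero if it annihilates all characters. -/
theorem ae_eq_zero_of_integral_cexp_eq_zero [IsFiniteMeasure γ] {φ : I → ℝ} (hφm : Measurable φ)
    (hφ : Integrable φ γ)
    (h : ∀ θ : ℕ →₀ Vec d, ∫ z : I, Complex.exp (pastForm θ z * Complex.I) * φ z ∂γ = 0) :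
    φ =ᵐ[γ] 0 := by
  -- The positive and negative parts of `φ` are densities of two finite measures with the same
  -- characteristic function, hence equal.
  let p : I → ℝ≥0 := fun z => (φ z).toNNReal
  let q : I → ℝ≥0 := fun z => (-φ z).toNNReal
  have hp : Measurable p := hφm.real_toNNReal
  have hq : Measurable q := hφm.neg.real_toNNReal
  have hpi : ∫⁻ z, p z ∂γ ≠ ∞ := hφ.lintegral_lt_top.ne
  have hqi : ∫⁻ z, q z ∂γ ≠ ∞ := hφ.neg.lintegral_lt_top.ne
  have : IsFiniteMeasure (γ.withDensity fun z => p z) := isFiniteMeasure_withDensity hpi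
  have : IsFiniteMeasure (γ.withDensity fun z => q z) := isFiniteMeasure_withDensity hqi
  have hval : Measurable (Subtype.val : I → PastSeq d) := measurable_subtype_coe
  have hmap : (γ.withDensity fun z => p z).map Subtype.val =
      (γ.withDensity fun z => q z).map Subtype.val := by
    refine ext_of_integral_cexp_pastForm fun θ => ?_
    have hc : Continuous fun z : PastSeq d => Complex.exp (pastForm θ z * Complex.I) := by
      have := continuous_pastForm θ
      fun_prop
    have hsmul {r : I → ℝ≥0} (hr : Integrable (fun z => (r z : ℝ)) γ) :
        Integrable (fun z : I => r z • Complex.exp (pastForm θ z * Complex.I)) γ := by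
      refine (hr.ofReal.bdd_mul (c := 1) (hc.comp continuous_subtype_val).aestronglyMeasurable
        (Eventually.of_forall fun z => ?_)).congr (Eventually.of_forall fun z => ?_)
      · simp [Complex.norm_exp_ofReal_mul_I]
      · simp only [Function.comp, NNReal.smul_def, Complex.real_smul]
        exact mul_comm _ _
    rw [integral_map hval.aemeasurable hc.aestronglyMeasurable,
      integral_map hval.aemeasurable hc.aestronglyMeasurable,
      integral_withDensity_eq_integral_smul hp, integral_withDensity_eq_integral_smul hq,
      ← sub_eq_zero, ← integral_sub]
    · rw [← h θ]
      congr 1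
      ext z
      have hz : ((p z : ℝ) : ℂ) - ((q z : ℝ) : ℂ) = φ z := by
        rw [← Complex.ofReal_sub]
        congr 1
        simp only [p, q, Real.coe_toNNReal']
        rcases le_total 0 (φ z) with h0 | h0 <;> simp [h0]
      rw [← hz]
      simp only [NNReal.smul_def, Complex.real_smul]
      ring
    · exact hsmul hφ.real_toNNReal
    · exact hsmul hφ.neg.real_toNNReal
  have heq : (γ.withDensity fun z => (p z : ℝ≥0∞)) = γ.withDensity fun z => (q z : ℝ≥0∞) := by
    ext s hs
    obtain ⟨T, hT, rfl⟩ := hs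
    have := congrArg (fun m => m T) hmap
    simpa only [Measure.map_apply hval hT] using this
  have hae := (withDensity_eq_iff hp.coe_nnreal_ennreal.aemeasurable
    hq.coe_nnreal_ennreal.aemeasurable hpi).1 heq
  filter_upwards [hae] with z hz
  have hz' : p z = q z := by exact_mod_cast hz
  simp only [p, q] at hz'
  rcases lt_trichotomy (φ z) 0 with h0 | h0 | h0
  · rw [Real.toNNReal_of_nonpos h0.le, eq_comm, Real.toNNReal_eq_zero] at hz'
    linarith
  · exact h0
  · rw [Real.toNNReal_of_nonpos (neg_nonpos.2 h0.le), Real.toNNReal_eq_zero] at hz'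
    linarith

/-- The activation functions admitted for the readout: the rectifier, or a bounded Lipschitz
non-constant function. -/
def IsActivation (σ : ℝ → ℝ) : Prop :=
  (σ = fun x => max x 0) ∨
    ((∃ R : ℝ, ∀ x, |σ x| ≤ R) ∧ (∃ L : ℝ≥0, LipschitzWith L σ) ∧ ∃ x y, σ x ≠ σ y)

theorem IsActivation.lipschitz {σ : ℝ → ℝ} (hσ : IsActivation σ) :
    ∃ L : ℝ≥0, LipschitzWith L σ := by
  rcases hσ with rfl | ⟨_, h, _⟩
  · exact ⟨1, LipschitzWith.id.max_const 0⟩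
  · exact h

/-- Some combination of two translates of an activation function is bounded, continuous and
non-constant. -/
theorem IsActivation.exists_bounded {σ : ℝ → ℝ} (hσ : IsActivation σ) :
    ∃ a : ℝ, Continuous (fun x => σ (x + 1) - a * σ x) ∧
      (∃ R : ℝ, ∀ x, |σ (x + 1) - a * σ x| ≤ R) ∧
      ∃ x y, σ (x + 1) - a * σ x ≠ σ (y + 1) - a * σ y := by
  obtain ⟨L, hL⟩ := hσ.lipschitz
  have hc := hL.continuous
  rcases hσ with rfl | ⟨⟨R, hR⟩, _, x, y, hxy⟩
  -- For the rectifier the difference of translates is a ramp from `0` to `1`; in the bounded case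
  -- `a = 0` leaves a mere translate.
  · refine ⟨1, by fun_prop, ⟨1, fun x => ?_⟩, 0, -1, by norm_num⟩
    simpa using abs_max_sub_max_le_abs (x + 1) x 0
  · exact ⟨0, by fun_prop, ⟨R, fun x => by simpa using hR (x + 1)⟩, x - 1, y - 1, by simpa using hxy⟩

/-- The hidden neurons are square integrable. -/
theorem memLp_neuron [IsFiniteMeasure γ] {σ : ℝ → ℝ} (hσ : IsActivation σ) {R : ℝ}
    (hR : ∀ z ∈ I, ∀ k, ‖z k‖ ≤ R) (q : (ℕ →₀ Vec d) × ℝ) :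
    MemLp (fun z : I => σ (pastForm q.1 z + q.2)) 2 γ := by
  obtain ⟨L, hL⟩ := hσ.lipschitz
  have hc : Continuous fun z : I => σ (pastForm q.1 z + q.2) :=
    hL.continuous.comp (((continuous_pastForm q.1).comp continuous_subtype_val).add_const _)
  obtain ⟨K, hK⟩ := (isCompact_closedBall (0 : ℝ)
    ((q.1.sum fun _ u => ‖u‖ * R) + |q.2|)).exists_bound_of_continuousOn hL.continuous.continuousOn
  refine MemLp.of_bound hc.aestronglyMeasurable K (Eventually.of_forall fun z => hK _ ?_)
  rw [mem_closedBall_zero_iff, Real.norm_eq_abs]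
  exact (abs_add_le _ _).trans (add_le_add_left (abs_pastForm_le q.1 (hR z z.2)) _)

/-- Finite combinations of hidden neurons are dense in `L²`. -/
theorem exists_network_approx [IsFiniteMeasure γ] {σ : ℝ → ℝ} (hσ : IsActivation σ) {R : ℝ}
    (hR : ∀ z ∈ I, ∀ k, ‖z k‖ ≤ R) {H : I → ℝ} (hH : MemLp H 2 γ) {e : ℝ≥0∞} (he : e ≠ 0) :
    ∃ f : ((ℕ →₀ Vec d) × ℝ) →₀ ℝ,
      MemLp (fun z : I => f.sum fun q v => v * σ (pastForm q.1 z + q.2)) 2 γ ∧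
      eLpNorm (fun z : I => H z - f.sum fun q v => v * σ (pastForm q.1 z + q.2)) 2 γ < e := by
  have hmem := memLp_neuron (γ := γ) hσ hR
  let u : (ℕ →₀ Vec d) × ℝ → Lp ℝ 2 γ := fun q => (hmem q).toLp
  have hdense : (Submodule.span ℝ (Set.range u)).topologicalClosure = ⊤ := by
    rw [Submodule.topologicalClosure_eq_top_iff, Submodule.eq_bot_iff]
    intro φ hφ
    have horth : ∀ (θ : ℕ →₀ Vec d) (b : ℝ), ∫ z : I, σ (pastForm θ z + b) * φ z ∂γ = 0 := by
      intro θ b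
      have h0 := (Submodule.mem_orthogonal _ _).1 hφ (u (θ, b)) (Submodule.subset_span ⟨_, rfl⟩)
      rw [L2.inner_def] at h0
      rw [← h0]
      refine integral_congr_ae ?_
      filter_upwards [(hmem (θ, b)).coeFn_toLp] with z hz
      simp only [u, hz, RCLike.inner_apply, conj_trivial]
      ring
    have hφi : Integrable φ γ := (Lp.memLp φ).integrable (by norm_num)
    obtain ⟨a, hac, ⟨K, hK⟩, x, y, hxy⟩ := hσ.exists_bounded
    have hz : φ =ᵐ[γ] 0 := by
      refine ae_eq_zero_of_integral_cexp_eq_zero (Lp.stronglyMeasurable φ).measurable hφi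
        fun θ => ?_
      have hm : Measurable fun z : I => pastForm θ z :=
        (continuous_pastForm θ).measurable.comp measurable_subtype_coe
      have hb : ∀ z : I, |pastForm θ z| ≤ _ := fun z => abs_pastForm_le θ (hR z z.2)
      refine integral_cexp_mul_eq_zero hφi hm hb
        (integral_pow_mul_eq_zero hac hK hxy hφi hm hb fun s b => ?_)
      have hint : ∀ b', Integrable (fun z : I => σ (s * pastForm θ z + b') * φ z) γ := fun b' => by
        have := (hmem (s • θ, b')).integrable_mul (Lp.memLp φ)
        simp only [pastForm_smul] at this
        exact this
      have hv : ∀ b', ∫ z : I, σ (s * pastForm θ z + b') * φ z ∂γ = 0 := fun b' => by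
        simpa only [pastForm_smul] using horth (s • θ) b'
      simp_rw [sub_mul, mul_assoc a, add_assoc]
      rw [integral_sub (hint _) ((hint _).const_mul a), integral_const_mul, hv, hv]
      simp
    exact Lp.ext (hz.trans (Lp.coeFn_zero _ _ _).symm)
  have hmemcl : hH.toLp ∈ closure (Submodule.span ℝ (Set.range u) : Set (Lp ℝ 2 γ)) := by
    rw [← Submodule.topologicalClosure_coe, hdense]
    trivial
  obtain ⟨k, hk, hke⟩ := EMetric.mem_closure_iff.1 hmemcl e (pos_iff_ne_zero.2 he)
  obtain ⟨f, rfl⟩ := Finsupp.mem_span_range_iff_exists_finsupp.1 hk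
  have hG : MemLp (fun z : I => f.sum fun q v => v * σ (pastForm q.1 z + q.2)) 2 γ :=
    memLp_finsetSum _ fun q _ => (hmem q).const_mul (f q)
  refine ⟨f, hG, ?_⟩
  have hGeq : hG.toLp = f.sum fun q v => v • u q := by
    refine Lp.ext (hG.coeFn_toLp.trans ?_)
    unfold Finsupp.sum
    refine EventuallyEq.trans ?_ (Lp.coeFn_fun_finsetSum _ _).symm
    have : ∀ᵐ z ∂γ, ∀ q ∈ f.support, (f q • u q : Lp ℝ 2 γ) z = f q * σ (pastForm q.1 z + q.2) := by
      rw [Filter.eventually_all_finset]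
      intro q _
      filter_upwards [(hmem q).coeFn_toLp, Lp.coeFn_smul (f q) (u q)] with z h1 h2
      rw [h2, Pi.smul_apply, smul_eq_mul, h1]
    filter_upwards [this] with z hz
    rw [Finset.sum_congr rfl fun q hq => (hz q hq)]
  rw [← hGeq, Lp.edist_toLp_toLp] at hke
  exact hke

end Universality

/-! ### Bounded solutions of contractive affine recursions and of the linear ESN. -/

section StateEquation

open Filter Topology

variable {E : Type*} [NormedAddCommGroup E] [NormedSpace ℝ E]

theorem norm_pow_apply_le {T : E →L[ℝ] E} {l : ℝ} (hT : ‖T‖ ≤ l) (n : ℕ) (v : E) :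
    ‖(T ^ n) v‖ ≤ l ^ n * ‖v‖ := by
  have hl : 0 ≤ l := (norm_nonneg T).trans hT
  induction n with
  | zero => simp
  | succ n ih =>
    rw [pow_succ', mul_apply_eq_comp, pow_succ', mul_assoc]
    exact (T.le_opNorm _).trans (mul_le_mul hT ih (norm_nonneg _) hl)

/-- Indices count backwards in time. Letting `n → ∞` yields the Neumann series; stopping at `n = N /
d` yields the truncation used to read inputs off the state. -/
theorem eq_sum_add_pow_of_recursion {T : E →L[ℝ] E} {f x : ℕ → E}
    (hx : ∀ k, x k = T (x (k + 1)) + f k) (n k : ℕ) :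
    x k = ∑ j ∈ Finset.range n, (T ^ j) (f (k + j)) + (T ^ n) (x (k + n)) := by
  induction n with
  | zero => simp
  | succ n ih =>
    rw [Finset.sum_range_succ, add_assoc, pow_succ, mul_apply_eq_comp, ← map_add,
      add_comm (f _), add_assoc k n 1 |>.symm, ← hx]
    exact ih

theorem summable_pow_apply [CompleteSpace E] {T : E →L[ℝ] E} {l : ℝ} (hT : ‖T‖ ≤ l) (hl : l < 1)
    {f : ℕ → E} {r : ℝ} (hf : ∀ k, ‖f k‖ ≤ r) (k : ℕ) :
    Summable fun j => (T ^ j) (f (k + j)) := by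
  have hl0 : 0 ≤ l := (norm_nonneg T).trans hT
  refine Summable.of_norm_bounded ((summable_geometric_of_lt_one hl0 hl).mul_right r) fun j => ?_
  exact (norm_pow_apply_le hT j _).trans (mul_le_mul_of_nonneg_left (hf _) (pow_nonneg hl0 j))

theorem norm_tsum_pow_apply_le {T : E →L[ℝ] E} {l : ℝ} (hT : ‖T‖ ≤ l) (hl : l < 1)
    {f : ℕ → E} {r : ℝ} (hf : ∀ k, ‖f k‖ ≤ r) (k : ℕ) :
    ‖∑' j, (T ^ j) (f (k + j))‖ ≤ (1 - l)⁻¹ * r := by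
  have hl0 : 0 ≤ l := (norm_nonneg T).trans hT
  exact tsum_of_norm_bounded ((hasSum_geometric_of_lt_one hl0 hl).mul_right r) fun j =>
    (norm_pow_apply_le hT j _).trans (mul_le_mul_of_nonneg_left (hf _) (pow_nonneg hl0 j))

/-- A bounded solution of a contractive affine recursion is given by its Neumann series. -/
theorem eq_tsum_of_recursion [CompleteSpace E] {T : E →L[ℝ] E} {l : ℝ} (hT : ‖T‖ ≤ l)
    (hl : l < 1) {f x : ℕ → E} {r : ℝ} (hf : ∀ k, ‖f k‖ ≤ r)
    (hx : ∀ k, x k = T (x (k + 1)) + f k) {M : ℝ} (hM : ∀ k, ‖x k‖ ≤ M) (k : ℕ) :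
    x k = ∑' j, (T ^ j) (f (k + j)) := by
  have hl0 : 0 ≤ l := (norm_nonneg T).trans hT
  have h1 := (summable_pow_apply hT hl hf k).hasSum.tendsto_sum_nat
  have h2 : Tendsto (fun n => (T ^ n) (x (k + n))) atTop (𝓝 0) := by
    refine squeeze_zero_norm (a := fun n => l ^ n * M) (fun n => ?_) ?_
    · exact (norm_pow_apply_le hT n _).trans (mul_le_mul_of_nonneg_left (hM _) (pow_nonneg hl0 n))
    · simpa using (tendsto_pow_atTop_nhds_zero_of_lt_one hl0 hl).mul_const M
  have h3 := h1.add h2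
  simp_rw [← eq_sum_add_pow_of_recursion hx, add_zero] at h3
  exact tendsto_nhds_unique tendsto_const_nhds h3

theorem tsum_pow_apply_recursion [CompleteSpace E] {T : E →L[ℝ] E} {l : ℝ} (hT : ‖T‖ ≤ l)
    (hl : l < 1) {f : ℕ → E} {r : ℝ} (hf : ∀ k, ‖f k‖ ≤ r) (k : ℕ) :
    ∑' j, (T ^ j) (f (k + j)) = T (∑' j, (T ^ j) (f (k + 1 + j))) + f k := by
  rw [(summable_pow_apply hT hl hf k).tsum_eq_zero_add,
    T.map_tsum (summable_pow_apply hT hl hf (k + 1)), add_comm]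
  congr 1
  refine tsum_congr fun j => ?_
  rw [pow_succ', mul_apply_eq_comp, show k + (j + 1) = k + 1 + j by ring]

/-- The operator between Euclidean spaces defined by a matrix. -/
def act {m n : ℕ} (M : Matrix (Fin m) (Fin n) ℝ) : Vec n →L[ℝ] Vec m :=
  (Matrix.toEuclideanLin M).toContinuousLinearMap

theorem act_apply {m n : ℕ} (M : Matrix (Fin m) (Fin n) ℝ) (v : Vec n) :
    act M v = WithLp.toLp 2 (M.mulVec v) := rfl

theorem norm_act {m n : ℕ} (M : Matrix (Fin m) (Fin n) ℝ) : ‖act M‖ = ‖M‖ := rfl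

theorem act_mul {k m n : ℕ} (M : Matrix (Fin k) (Fin m) ℝ) (M' : Matrix (Fin m) (Fin n) ℝ)
    (v : Vec n) : act (M * M') v = act M (act M' v) := by
  simp [act_apply, Matrix.mulVec_mulVec]

theorem act_pow {n : ℕ} (M : Matrix (Fin n) (Fin n) ℝ) (j : ℕ) (v : Vec n) :
    act (M ^ j) v = (act M ^ j) v := by
  induction j with
  | zero => simp [act_apply]
  | succ j ih => rw [pow_succ', act_mul, ih, pow_succ', mul_apply_eq_comp]

theorem inner_act {m n : ℕ} (M : Matrix (Fin m) (Fin n) ℝ) (u : Vec m) (v : Vec n) :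
    inner ℝ u (act M v) = inner ℝ (act M.transpose u) v := by
  simp only [act_apply, EuclideanSpace.inner_eq_star_dotProduct, star_trivial]
  rw [Matrix.mulVec_transpose, dotProduct_comm, Matrix.dotProduct_mulVec, dotProduct_comm]

variable {N d : ℕ} {A : Matrix (Fin N) (Fin N) ℝ} {B : Vec N} {C : Matrix (Fin N) (Fin d) ℝ}
  {z : PastSeq d}

theorem isBoundedSolution_id_iff {x : PastSeq N} :
    IsBoundedSolution id A B C z x ↔
      (∀ k, x k = act A (x (k + 1)) + (act C (z k) + B)) ∧ ∃ R : ℝ, ∀ k, ‖x k‖ ≤ R := by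
  refine and_congr_left fun _ => forall_congr' fun k => ?_
  constructor
  · intro h
    ext i
    simp [h i, act_apply, add_assoc]
  · intro h i
    conv_lhs => rw [h]
    simp [act_apply, add_assoc]

theorem norm_input_le {c R : ℝ} (hC : ‖C‖ ≤ c) (hB : ‖B‖ ≤ c)
    (hz : ∀ k, ‖z k‖ ≤ R) (k : ℕ) : ‖act C (z k) + B‖ ≤ c * R + c := by
  refine (norm_add_le _ _).trans (add_le_add ?_ hB)
  refine ((act C).le_opNorm _).trans ?_
  rw [norm_act]
  exact mul_le_mul hC (hz k) (norm_nonneg _) ((norm_nonneg _).trans hC)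

/-- A contractive linear echo state network has a unique bounded solution. -/
theorem existsUnique_isBoundedSolution (hA : ‖A‖ < 1) {R : ℝ} (hz : ∀ k, ‖z k‖ ≤ R) :
    ∃! x, IsBoundedSolution id A B C z x := by
  let f : ℕ → Vec N := fun k => act C (z k) + B
  have hf : ∀ k, ‖f k‖ ≤ max ‖C‖ ‖B‖ * R + max ‖C‖ ‖B‖ :=
    norm_input_le (le_max_left _ _) (le_max_right _ _) hz
  have hT : ‖act A‖ ≤ ‖A‖ := (norm_act A).le
  refine ⟨fun k => ∑' j, (act A ^ j) (f (k + j)), ?_, fun x hx => ?_⟩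
  · exact isBoundedSolution_id_iff.2 ⟨tsum_pow_apply_recursion hT hA hf,
      _, norm_tsum_pow_apply_le hT hA hf⟩
  · obtain ⟨h1, M, hM⟩ := isBoundedSolution_id_iff.1 hx
    exact funext fun k => eq_tsum_of_recursion (f := f) hT hA hf h1 hM k

theorem state_recursion (hA : ‖A‖ < 1) {R : ℝ} (hz : ∀ k, ‖z k‖ ≤ R) (k : ℕ) :
    state id A B C z k = act A (state id A B C z (k + 1)) + (act C (z k) + B) :=
  (isBoundedSolution_id_iff.1
    (Classical.epsilon_spec (existsUnique_isBoundedSolution (B := B) (C := C) hA hz).exists)).1 k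

theorem norm_state_le {c l R : ℝ} (hA : ‖A‖ ≤ l) (hl : l < 1) (hC : ‖C‖ ≤ c) (hB : ‖B‖ ≤ c)
    (hz : ∀ k, ‖z k‖ ≤ R) (k : ℕ) : ‖state id A B C z k‖ ≤ (1 - l)⁻¹ * (c * R + c) := by
  let f : ℕ → Vec N := fun k => act C (z k) + B
  have hf : ∀ k, ‖f k‖ ≤ c * R + c := norm_input_le hC hB hz
  have hT : ‖act A‖ ≤ l := (norm_act A).trans_le hA
  obtain ⟨h1, M, hM⟩ := isBoundedSolution_id_iff.1 (Classical.epsilon_spec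
    (existsUnique_isBoundedSolution (B := B) (C := C) (hA.trans_lt hl) hz).exists)
  have h := eq_tsum_of_recursion (f := f) hT hl hf h1 hM k
  rw [state, h]
  exact norm_tsum_pow_apply_le hT hl hf k

end StateEquation

/-! ### Recovering past inputs from the state through the controllability matrix. -/

section Controllability

variable {N d : ℕ} {A : Matrix (Fin N) (Fin N) ℝ} {B : Vec N} {C : Matrix (Fin N) (Fin d) ℝ}

/-- The current input is split off because a neuron receives it directly, while `x_{-1}` carries the
inputs from `z_{-1}` on; hence the shift by one. -/
theorem pastForm_eq_sum {θ : ℕ →₀ Vec d} {n : ℕ} (hθ : ∀ j, n ≤ j → θ (j + 1) = 0)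
    (z : PastSeq d) :
    pastForm θ z =
      ∑ j ∈ Finset.range n, inner ℝ (θ (j + 1)) (z (1 + j)) + inner ℝ (θ 0) (z 0) := by
  have hsub : θ.support ⊆ Finset.range (n + 1) := by
    intro k hk
    rw [Finset.mem_range]
    by_contra! h
    obtain ⟨j, rfl⟩ : ∃ j, k = j + 1 := ⟨k - 1, by omega⟩
    exact (Finsupp.mem_support_iff.1 hk) (hθ j (by omega))
  rw [pastForm, Finsupp.sum_of_support_subset _ hsub _ (by simp), Finset.sum_range_succ']
  simp_rw [add_comm 1]

/-- The coefficients of `z_{-1}, z_{-2}, …` in `pastForm θ`, stacked into one sequence and weighted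
by `l^{-k}` in block `k`. -/
def stackedCoeff [NeZero d] (θ : ℕ →₀ Vec d) (l : ℝ) (m : ℕ) : ℝ :=
  (l ^ (m / d))⁻¹ * θ (m / d + 1) (Fin.ofNat d m)

/-- The factors `l^{-k}` do no harm: `θ` has finite support, so only entries below some `d * T` can
be nonzero, whatever `N` is. -/
theorem norm_stackedCoeff_le [NeZero d] (θ : ℕ →₀ Vec d) (l : ℝ) :
    ∃ S : ℝ, 0 ≤ S ∧ ∀ N : ℕ, ‖(WithLp.toLp 2 fun m : Fin N => stackedCoeff θ l m : Vec N)‖ ≤ S := by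
  obtain ⟨T, hT⟩ := θ.support.exists_nat_subset_range
  refine ⟨√(∑ m ∈ Finset.range (d * T), stackedCoeff θ l m ^ 2), Real.sqrt_nonneg _, fun N => ?_⟩
  rw [EuclideanSpace.norm_eq]
  refine Real.sqrt_le_sqrt ?_
  simp only [Real.norm_eq_abs, sq_abs]
  rw [Fin.sum_univ_eq_sum_range (fun m => stackedCoeff θ l m ^ 2) N]
  have hsub {a b : ℕ} (hab : a ≤ b) : Finset.range a ⊆ Finset.range b :=
    Finset.range_subset_range.2 hab
  refine (Finset.sum_le_sum_of_subset_of_nonneg (hsub (le_max_left N (d * T)))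
    fun _ _ _ => sq_nonneg _).trans_eq
    (Finset.sum_subset (hsub (le_max_right N (d * T))) fun m _ hm => ?_).symm
  have h : d * T ≤ m := by simpa using hm
  have h1 : θ (m / d + 1) = 0 := by
    by_contra h0
    have := Finset.mem_range.1 (hT (Finsupp.mem_support_iff.2 h0))
    have : T ≤ m / d := (Nat.le_div_iff_mul_le (NeZero.pos d)).2 (by rwa [mul_comm])
    omega
  simp [stackedCoeff, h1]

/-- The state weight that reads the functional `pastForm θ` off the state. -/
def readoutWeight [NeZero d] (A : Matrix (Fin N) (Fin N) ℝ) (C : Matrix (Fin N) (Fin d) ℝ)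
    (l : ℝ) (θ : ℕ →₀ Vec d) : Vec N :=
  act ((controllability A C)⁻¹.transpose * decay N d l)
    (WithLp.toLp 2 fun m : Fin N => stackedCoeff θ l m)

/-- The factor `lᵏ` in `decay` cancels the weighting of `stackedCoeff`, so `Kᵀ` maps the readout
weight to the plain coefficients. For `j < N / d` the whole block `Aʲ C` lies among the columns of
`K`. -/
theorem inner_readoutWeight [NeZero d] (hK : IsUnit (controllability A C)) {l : ℝ} (hl : 0 < l)
    (θ : ℕ →₀ Vec d) {j : ℕ} (hj : j < N / d) (v : Vec d) :
    inner ℝ (readoutWeight A C l θ) ((act A ^ j) (act C v)) = inner ℝ (θ (j + 1)) v := by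
  rw [← act_pow, ← act_mul, inner_act]
  congr 1
  ext i
  have hd : 0 < d := NeZero.pos d
  have hm : d * j + i < N := by
    have h1 : d * (j + 1) ≤ N := (Nat.mul_le_mul_left d hj).trans (Nat.mul_div_le N d)
    have := i.2
    rw [mul_add] at h1
    omega
  have hdiv : (d * j + i) / d = j := by
    rw [Nat.mul_add_div hd, Nat.div_eq_of_lt i.2, add_zero]
  have hmod : Fin.ofNat d (d * j + i) = i := by
    ext
    simp [Fin.ofNat, Nat.mod_eq_of_lt i.2]
  have hu : (controllability A C).transpose.mulVec (readoutWeight A C l θ) =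
      fun m : Fin N => θ ((m : ℕ) / d + 1) (Fin.ofNat d m) := by
    have hdet : IsUnit (controllability A C).det := (Matrix.isUnit_iff_isUnit_det _).1 hK
    rw [readoutWeight, act_apply, Matrix.mulVec_mulVec, ← mul_assoc, ← Matrix.transpose_mul,
      Matrix.nonsing_inv_mul _ hdet, Matrix.transpose_one, one_mul]
    ext m
    rw [decay, Matrix.mulVec_diagonal]
    have : l ^ ((m : ℕ) / d) ≠ 0 := by positivity
    simp only [stackedCoeff]
    field_simp
  have := congrFun hu ⟨d * j + i, hm⟩
  simp only [hdiv, hmod] at this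
  rw [← this, act_apply]
  simp only [Matrix.mulVec, dotProduct, Matrix.transpose_apply, controllability, Matrix.of_apply,
    hdiv, hmod]

/-- A functional of finitely many past inputs can be read off the state up to a constant and an
exponentially small error, with weights that are bounded independently of the state dimension. -/
theorem exists_state_weight [NeZero d] (θ : ℕ →₀ Vec d) {c l₀ l₁ R : ℝ} (hc : 0 < c) (hl₀ : 0 < l₀)
    (hl0 : 0 ≤ l₁) (hl₁ : l₁ < 1) (hR : 0 ≤ R) :
    ∃ Q : ℝ, 0 ≤ Q ∧ ∀ (N : ℕ) (A : Matrix (Fin N) (Fin N) ℝ) (B : Vec N)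
      (C : Matrix (Fin N) (Fin d) ℝ), IsUnit (controllability A C) → ‖A‖ ≤ l₁ → ‖B‖ ≤ c → ‖C‖ ≤ c →
      ‖(controllability A C)⁻¹.transpose * decay N d l₀‖ ≤ c → (∀ j, N / d ≤ j → θ (j + 1) = 0) →
      ∃ (α : Vec N) (β : ℝ), ‖α‖ ≤ Q ∧ |β| ≤ Q ∧ ∀ z : PastSeq d, (∀ k, ‖z k‖ ≤ R) →
        |inner ℝ α (state id A B C z 1) + inner ℝ (θ 0) (z 0) + β - pastForm θ z| ≤
          Q * l₁ ^ (N / d) := by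
  obtain ⟨S, hS0, hS⟩ := norm_stackedCoeff_le θ l₀
  have h1l : 0 < 1 - l₁ := by linarith
  -- `Q₁` bounds `α`, `Q₂` the bias correction, and `Q₃` the factor in front of `l₁ ^ (N / d)` in
  -- the remainder.
  set Q₁ := c * S with hQ₁
  set Q₂ := Q₁ * ((1 - l₁)⁻¹ * c) with hQ₂
  set Q₃ := Q₁ * ((1 - l₁)⁻¹ * (c * R + c)) with hQ₃
  have hQ₁0 : 0 ≤ Q₁ := by positivity
  have hQ₂0 : 0 ≤ Q₂ := by positivity
  have hQ₃0 : 0 ≤ Q₃ := by positivity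
  refine ⟨Q₁ + Q₂ + Q₃, by positivity, fun N A B C hK hA hB hC hKΛ hθ => ?_⟩
  set α := readoutWeight A C l₀ θ with hα
  have hT : ‖act A‖ ≤ l₁ := (norm_act A).trans_le hA
  have hαn : ‖α‖ ≤ Q₁ := by
    refine ((act _).le_opNorm _).trans ?_
    rw [norm_act]
    exact mul_le_mul hKΛ (hS N) (norm_nonneg _) hc.le
  -- `β` cancels what the constant input `B` has contributed to the state over the unrolled steps.
  refine ⟨α, -∑ j ∈ Finset.range (N / d), inner ℝ α ((act A ^ j) B), by linarith, ?_,
    fun z hz => ?_⟩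
  · rw [abs_neg]
    have : |∑ j ∈ Finset.range (N / d), inner ℝ α ((act A ^ j) B)| ≤ Q₂ := by
      calc |∑ j ∈ Finset.range (N / d), inner ℝ α ((act A ^ j) B)|
          ≤ ∑ j ∈ Finset.range (N / d), |inner ℝ α ((act A ^ j) B)| :=
            Finset.abs_sum_le_sum_abs _ _
        _ ≤ ∑ j ∈ Finset.range (N / d), l₁ ^ j * (Q₁ * c) := by
          refine Finset.sum_le_sum fun j _ => (abs_real_inner_le_norm _ _).trans ?_
          calc ‖α‖ * ‖(act A ^ j) B‖ ≤ Q₁ * (l₁ ^ j * c) := by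
                gcongr
                exact (norm_pow_apply_le hT j B).trans (by gcongr)
            _ = _ := by ring
        _ = (∑ j ∈ Finset.range (N / d), l₁ ^ j) * (Q₁ * c) := by rw [Finset.sum_mul]
        _ ≤ (1 - l₁)⁻¹ * (Q₁ * c) := by
          gcongr
          exact (summable_geometric_of_lt_one hl0 hl₁).sum_le_tsum _ (fun _ _ => by positivity)
            |>.trans_eq (tsum_geometric_of_lt_one hl0 hl₁)
        _ = Q₂ := by rw [hQ₂]; ring
    linarith
  · have hrec := eq_sum_add_pow_of_recursion (f := fun k => act C (z k) + B)
      (state_recursion (B := B) (C := C) (hA.trans_lt hl₁) hz) (N / d) 1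
    rw [hrec, pastForm_eq_sum hθ]
    simp only [inner_add_right, inner_sum, map_add, Finset.sum_add_distrib]
    have hsum : ∑ j ∈ Finset.range (N / d), inner ℝ α ((act A ^ j) (act C (z (1 + j)))) =
        ∑ j ∈ Finset.range (N / d), inner ℝ (θ (j + 1)) (z (1 + j)) :=
      Finset.sum_congr rfl fun j hj =>
        inner_readoutWeight hK hl₀ θ (Finset.mem_range.1 hj) _
    rw [hsum]
    have herr : |inner ℝ α ((act A ^ (N / d)) (state id A B C z (1 + N / d)))| ≤
        Q₃ * l₁ ^ (N / d) := by
      refine (abs_real_inner_le_norm _ _).trans ?_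
      calc ‖α‖ * ‖(act A ^ (N / d)) (state id A B C z (1 + N / d))‖
          ≤ Q₁ * (l₁ ^ (N / d) * ((1 - l₁)⁻¹ * (c * R + c))) := by
            gcongr
            exact (norm_pow_apply_le hT _ _).trans
              (by gcongr; exact norm_state_le hA hl₁ hC hB hz _)
        _ = _ := by rw [hQ₃]; ring
    have hle : Q₃ * l₁ ^ (N / d) ≤ (Q₁ + Q₂ + Q₃) * l₁ ^ (N / d) := by
      gcongr
      linarith
    refine le_trans (le_of_eq ?_) (herr.trans hle)
    congr 1
    ring

end Controllability

/-! ### Wasserstein cost of mixing in another measure. -/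

section Mixture

variable {N d : ℕ}

theorem weightNorm_nonneg (x : Weights N d) : 0 ≤ weightNorm x := Real.sqrt_nonneg _

/-- The crude factor `2` comes from `‖u - v‖² ≤ 2‖u‖² + 2‖v‖²` in each component. It suffices, since
the cost is later multiplied by a small mass. -/
theorem weightNorm_sub_le (x y : Weights N d) :
    weightNorm (x - y) ≤ 2 * (weightNorm x + weightNorm y) := by
  have hx := weightNorm_nonneg x
  have hy := weightNorm_nonneg y
  have hx2 : weightNorm x ^ 2 = x.1 ^ 2 + ‖x.2.1‖ ^ 2 + ‖x.2.2.1‖ ^ 2 + x.2.2.2 ^ 2 :=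
    Real.sq_sqrt (by positivity)
  have hy2 : weightNorm y ^ 2 = y.1 ^ 2 + ‖y.2.1‖ ^ 2 + ‖y.2.2.1‖ ^ 2 + y.2.2.2 ^ 2 :=
    Real.sq_sqrt (by positivity)
  have hnorm {E : Type} [NormedAddCommGroup E] (u v : E) :
      ‖u - v‖ ^ 2 ≤ 2 * ‖u‖ ^ 2 + 2 * ‖v‖ ^ 2 := by
    have h1 := norm_sub_le u v
    have h2 : ‖u - v‖ ^ 2 ≤ (‖u‖ + ‖v‖) ^ 2 := pow_le_pow_left₀ (norm_nonneg _) h1 2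
    linarith [sq_nonneg (‖u‖ - ‖v‖)]
  refine Real.sqrt_le_iff.2 ⟨by positivity, ?_⟩
  have h1 := hnorm x.2.1 y.2.1
  have h2 := hnorm x.2.2.1 y.2.2.1
  simp only [Prod.fst_sub, Prod.snd_sub]
  linarith [sq_nonneg (x.1 + y.1), sq_nonneg (x.2.2.2 + y.2.2.2), sq_nonneg (weightNorm x),
    sq_nonneg (weightNorm y), mul_nonneg hx hy]

theorem measurable_weightNorm : Measurable (weightNorm : Weights N d → ℝ) := by
  unfold weightNorm
  fun_prop

/-- Moving a fraction `b` of the mass of `ν` to `μ` costs at most a multiple of `b`. -/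
theorem wasserstein1_mixture_le (ν μ : Measure (Weights N d)) [IsProbabilityMeasure ν]
    [IsProbabilityMeasure μ] {a b : ℝ≥0∞} (hab : a + b = 1) :
    wasserstein1 ν (a • ν + b • μ) ≤ b * (2 * (firstMoment ν + firstMoment μ)) := by
  -- Mass `a` stays in place on the diagonal at no cost; mass `b` moves by the independent coupling.
  let π : Measure (Weights N d × Weights N d) :=
    a • ν.map (fun x => (x, x)) + b • ν.prod μ
  have hdiag : Measurable fun x : Weights N d => (x, x) := by fun_prop
  have hπ : IsCoupling π ν (a • ν + b • μ) := by
    constructor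
    · simp only [π]
      rw [Measure.map_add _ _ measurable_fst, Measure.map_smul, Measure.map_smul,
        Measure.map_map measurable_fst hdiag, Measure.map_fst_prod]
      simp [Function.comp_def, ← add_smul, hab]
    · simp only [π]
      rw [Measure.map_add _ _ measurable_snd, Measure.map_smul, Measure.map_smul,
        Measure.map_map measurable_snd hdiag, Measure.map_snd_prod]
      simp [Function.comp_def]
  refine (iInf₂_le π hπ).trans ?_
  have hm : Measurable fun p : Weights N d × Weights N d =>
      ENNReal.ofReal (weightNorm (p.1 - p.2)) :=
    (measurable_weightNorm.comp (measurable_fst.sub measurable_snd)).ennreal_ofReal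
  have hmw : Measurable fun x : Weights N d => ENNReal.ofReal (weightNorm x) :=
    measurable_weightNorm.ennreal_ofReal
  simp only [π]
  rw [lintegral_add_measure, lintegral_smul_measure, lintegral_smul_measure,
    lintegral_map hm hdiag]
  have h0 : ∀ x : Weights N d, ENNReal.ofReal (weightNorm (x - x)) = 0 := by
    intro x
    simp [weightNorm]
  simp only [h0, lintegral_zero, smul_eq_mul, mul_zero, zero_add]
  gcongr
  calc ∫⁻ p, ENNReal.ofReal (weightNorm (p.1 - p.2)) ∂ν.prod μ
      ≤ ∫⁻ p, 2 * (ENNReal.ofReal (weightNorm p.1) + ENNReal.ofReal (weightNorm p.2))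
          ∂ν.prod μ := by
        refine lintegral_mono fun p => ?_
        refine (ENNReal.ofReal_le_ofReal (weightNorm_sub_le _ _)).trans_eq ?_
        rw [ENNReal.ofReal_mul zero_le_two, ENNReal.ofReal_ofNat,
          ENNReal.ofReal_add (weightNorm_nonneg _) (weightNorm_nonneg _)]
    _ = 2 * (firstMoment ν + firstMoment μ) := by
        have hm₁ : Measurable fun p : Weights N d × Weights N d =>
            ENNReal.ofReal (weightNorm p.1) := hmw.comp measurable_fst
        have hm₂ : Measurable fun p : Weights N d × Weights N d =>
            ENNReal.ofReal (weightNorm p.2) := hmw.comp measurable_snd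
        rw [lintegral_const_mul _ (by fun_prop), lintegral_add_left hm₁]
        congr 2
        · rw [← lintegral_map (μ := ν.prod μ) (g := Prod.fst) hmw measurable_fst,
            Measure.map_fst_prod]
          simp [firstMoment]
        · rw [← lintegral_map (μ := ν.prod μ) (g := Prod.snd) hmw measurable_snd,
            Measure.map_snd_prod]
          simp [firstMoment]

end Mixture

/-! ### Reproducing a finite network from i.i.d. hidden weights. -/

section Sampling

variable {X ι : Type*} [Fintype ι] {N : ℕ}

/-- The event that all points of a family are hit by a sample. -/
def hitAll (p : ι → X) : Set (Fin N → X) := {ξ | ∀ j, ∃ i, ξ i = p j}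

open Classical in
/-- The readout that reproduces a combination of finitely many neurons from a sample of hidden
weights that contains all of them: the coefficient of each neuron is distributed evenly among the
sample points where it occurs. -/
def sampleReadout (p : ι → X) (v : ι → ℝ) (ξ : Fin N → X) (i : Fin N) : ℝ :=
  if ξ ∈ hitAll p then
    ∑ j, if ξ i = p j then v j / ∑ i', (if ξ i' = p j then 1 else 0) else 0
  else 0

theorem sum_sampleReadout_of_mem {p : ι → X} {ξ : Fin N → X} (hξ : ξ ∈ hitAll p) (v : ι → ℝ)
    (F : X → ℝ) : ∑ i, sampleReadout p v ξ i * F (ξ i) = ∑ j, v j * F (p j) := by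
  classical
  simp only [sampleReadout, if_pos hξ, Finset.sum_mul]
  rw [Finset.sum_comm]
  refine Finset.sum_congr rfl fun j _ => ?_
  set n : ℝ := ∑ i', (if ξ i' = p j then 1 else 0) with hn
  have hn0 : n ≠ 0 := by
    obtain ⟨i, hi⟩ := hξ j
    have : (1 : ℝ) ≤ n := by
      rw [hn]
      refine le_trans ?_ (Finset.single_le_sum (f := fun i' => if ξ i' = p j then (1 : ℝ) else 0)
        (fun i' _ => by positivity) (Finset.mem_univ i))
      simp [hi]
    linarith
  calc ∑ i, (if ξ i = p j then v j / n else 0) * F (ξ i)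
      = ∑ i, v j / n * F (p j) * (if ξ i = p j then 1 else 0) := by
        refine Finset.sum_congr rfl fun i _ => ?_
        split_ifs with h
        · rw [h, mul_one]
        · simp
    _ = v j * F (p j) := by
        rw [← Finset.mul_sum, ← hn]
        field_simp

theorem sampleReadout_of_notMem {p : ι → X} {ξ : Fin N → X} (hξ : ξ ∉ hitAll p) (v : ι → ℝ) :
    sampleReadout p v ξ = 0 := by
  ext i
  simp [sampleReadout, hξ]

variable [MeasurableSpace X]

/-- The uniform distribution on a finite family of points. -/
def empirical (p : ι → X) : Measure X :=
  ∑ j, (Fintype.card ι : ℝ≥0∞)⁻¹ • Measure.dirac (p j)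

theorem card_mul_inv_eq_one [Nonempty ι] :
    (Fintype.card ι : ℝ≥0∞) * (Fintype.card ι : ℝ≥0∞)⁻¹ = 1 :=
  ENNReal.mul_inv_cancel (by simp) (by simp)

instance [Nonempty ι] (p : ι → X) : IsProbabilityMeasure (empirical p) :=
  ⟨by simp [empirical, card_mul_inv_eq_one]⟩

theorem lintegral_empirical_le [Nonempty ι] (p : ι → X) {g : X → ℝ≥0∞} (hg : Measurable g)
    {K : ℝ≥0∞} (hK : ∀ j, g (p j) ≤ K) : ∫⁻ x, g x ∂empirical p ≤ K := by
  rw [empirical, lintegral_finsetSum_measure]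
  calc ∑ j, ∫⁻ x, g x ∂((Fintype.card ι : ℝ≥0∞)⁻¹ • Measure.dirac (p j))
      ≤ ∑ _j : ι, (Fintype.card ι : ℝ≥0∞)⁻¹ * K := by
        refine Finset.sum_le_sum fun j _ => ?_
        rw [lintegral_smul_measure, lintegral_dirac' _ hg, smul_eq_mul]
        gcongr
        exact hK j
    _ = K := by
        rw [Finset.sum_const, nsmul_eq_mul, ← mul_assoc, Finset.card_univ, card_mul_inv_eq_one,
          one_mul]

/-- Only an inequality, because the points of the family may coincide. -/
theorem inv_card_le_empirical [MeasurableSingletonClass X] (p : ι → X) (j : ι) :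
    (Fintype.card ι : ℝ≥0∞)⁻¹ ≤ empirical p {p j} := by
  classical
  rw [empirical, Measure.finsetSum_apply]
  refine le_trans ?_ (Finset.single_le_sum (fun _ _ => zero_le) (Finset.mem_univ j))
  simp

variable [MeasurableSingletonClass X]

theorem measurableSet_coord_eq (i : Fin N) (x : X) : MeasurableSet {ξ : Fin N → X | ξ i = x} :=
  (measurable_pi_apply i : Measurable fun ξ : Fin N → X => ξ i) (measurableSet_singleton x)

theorem measurableSet_hitAll (p : ι → X) : MeasurableSet (hitAll p : Set (Fin N → X)) := by
  have : (hitAll p : Set (Fin N → X)) = ⋂ j, ⋃ i, {ξ | ξ i = p j} := by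
    ext ξ
    simp [hitAll]
  rw [this]
  exact .iInter fun j => .iUnion fun i => measurableSet_coord_eq i (p j)

/-- Union bound over the points: all `N` independent draws miss a given one with probability at most
`(1 - b) ^ N`. -/
theorem pi_compl_hitAll_le (ν : Measure X) [IsProbabilityMeasure ν] (p : ι → X) {b : ℝ≥0∞}
    (hb : ∀ j, b ≤ ν {p j}) :
    Measure.pi (fun _ : Fin N => ν) (hitAll p)ᶜ ≤ Fintype.card ι * (1 - b) ^ N := by
  have : (hitAll p : Set (Fin N → X))ᶜ ⊆ ⋃ j, Set.univ.pi fun _ : Fin N => {p j}ᶜ := by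
    intro ξ hξ
    simpa [hitAll, Set.mem_pi] using hξ
  refine (measure_mono this).trans ((measure_iUnion_fintype_le _ _).trans ?_)
  calc ∑ j, Measure.pi (fun _ : Fin N => ν) (Set.univ.pi fun _ : Fin N => {p j}ᶜ)
      ≤ ∑ _j : ι, (1 - b) ^ N := by
        refine Finset.sum_le_sum fun j _ => ?_
        rw [Measure.pi_pi, Finset.prod_const, Finset.card_univ, Fintype.card_fin,
          prob_compl_eq_one_sub (measurableSet_singleton _)]
        gcongr
        exact hb j
    _ = _ := by simp

theorem measurable_sampleReadout (p : ι → X) (v : ι → ℝ) :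
    Measurable (sampleReadout p v : (Fin N → X) → Fin N → ℝ) := by
  classical
  refine measurable_pi_lambda _ fun i => ?_
  refine Measurable.ite (measurableSet_hitAll p) ?_ measurable_const
  refine Finset.measurable_sum _ fun j _ => ?_
  refine Measurable.ite (measurableSet_coord_eq i (p j)) ?_ measurable_const
  refine measurable_const.div (Finset.measurable_sum _ fun i' _ => ?_)
  exact Measurable.ite (measurableSet_coord_eq i' (p j)) measurable_const measurable_const

/-- The mean square error of the sampled network is the error of the network that it reproduces,
up to the probability that the sample misses one of the neurons. -/
theorem lintegral_sampleReadout_le (ν : Measure X) [IsProbabilityMeasure ν] (p : ι → X) (v : ι → ℝ)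
    (F : X → ℝ) (y : ℝ) :
    ∫⁻ ξ, ‖y - ∑ i, sampleReadout p v ξ i * F (ξ i)‖ₑ ^ 2 ∂(Measure.pi fun _ : Fin N => ν) ≤
      ‖y - ∑ j, v j * F (p j)‖ₑ ^ 2 +
        Measure.pi (fun _ : Fin N => ν) (hitAll p)ᶜ * ‖y‖ₑ ^ 2 := by
  calc ∫⁻ ξ, ‖y - ∑ i, sampleReadout p v ξ i * F (ξ i)‖ₑ ^ 2 ∂(Measure.pi fun _ : Fin N => ν)
      ≤ ∫⁻ ξ, (‖y - ∑ j, v j * F (p j)‖ₑ ^ 2 + (hitAll p)ᶜ.indicator (fun _ => ‖y‖ₑ ^ 2) ξ)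
          ∂(Measure.pi fun _ : Fin N => ν) := by
        refine lintegral_mono fun ξ => ?_
        by_cases hξ : ξ ∈ hitAll p
        · rw [sum_sampleReadout_of_mem hξ]
          exact le_self_add
        · rw [sampleReadout_of_notMem hξ, Set.indicator_of_mem (Set.mem_compl hξ)]
          simp
    _ = _ := by
        rw [lintegral_add_left measurable_const,
          lintegral_indicator_const (measurableSet_hitAll p).compl, lintegral_const, measure_univ,
          mul_one, mul_comm (‖y‖ₑ ^ 2)]

end Sampling

/-! ### Neurons on the state that approximate neurons on the past. -/

section Approximation

open Filter Topology

/-- A hidden neuron that acts on finitely many past inputs is approximated, uniformly in the input,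
by neurons that act on the state and the current input, with weights bounded independently of the
state dimension. -/
theorem eventually_exists_weights {d : ℕ} [NeZero d] {R c l₀ l₁ : ℝ} (hR0 : 0 ≤ R)
    {σ : ℝ → ℝ} {L : ℝ≥0} (hσ : LipschitzWith L σ)
    {A : (N : ℕ) → Matrix (Fin N) (Fin N) ℝ} {B : (N : ℕ) → Vec N}
    {C : (N : ℕ) → Matrix (Fin N) (Fin d) ℝ} (hc : 0 < c) (hl₀ : 0 < l₀) (hl0 : 0 ≤ l₁)
    (hl₁ : l₁ < 1) (hK : ∀ N, 1 ≤ N → IsUnit (controllability (A N) (C N)))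
    (hA : ∀ N, 1 ≤ N → ‖A N‖ ≤ l₁) (hB : ∀ N, 1 ≤ N → ‖B N‖ ≤ c) (hC : ∀ N, 1 ≤ N → ‖C N‖ ≤ c)
    (hKΛ : ∀ N, 1 ≤ N → ‖((controllability (A N) (C N))⁻¹).transpose * decay N d l₀‖ ≤ c)
    (q : (ℕ →₀ Vec d) × ℝ) :
    ∃ P : ℝ, 0 ≤ P ∧ ∀ η : ℝ, 0 < η → ∀ᶠ N in atTop, ∃ x : Weights N d, weightNorm x ≤ P ∧
      ∀ z : PastSeq d, (∀ k, ‖z k‖ ≤ R) →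
        |σ (inner ℝ x.2.1 (state id (A N) (B N) (C N) z 1) + inner ℝ x.2.2.1 (z 0) + x.2.2.2) -
          σ (pastForm q.1 z + q.2)| ≤ η := by
  obtain ⟨θ, b⟩ := q
  obtain ⟨Q, hQ0, hQ⟩ := exists_state_weight θ hc hl₀ hl0 hl₁ hR0
  refine ⟨Q + ‖θ 0‖ + (|b| + Q), by positivity, fun η hη => ?_⟩
  have hdiv : Tendsto (fun N : ℕ => N / d) atTop atTop :=
    Nat.tendsto_div_const_atTop (NeZero.ne d)
  have hlim : Tendsto (fun N : ℕ => L * (Q * l₁ ^ (N / d))) atTop (𝓝 0) := by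
    simpa using (((tendsto_pow_atTop_nhds_zero_of_lt_one hl0 hl₁).comp hdiv).const_mul
      Q).const_mul (L : ℝ)
  obtain ⟨T, hT⟩ := θ.support.exists_nat_subset_range
  -- Once `T ≤ N / d`, every past input on which `θ` depends is covered by a full block of `K`.
  filter_upwards [hdiv.eventually_ge_atTop T, hlim.eventually_lt_const hη, eventually_ge_atTop 1]
    with N hNT hNη hN
  obtain ⟨α, β, hα, hβ, h⟩ := hQ N (A N) (B N) (C N) (hK N hN) (hA N hN) (hB N hN) (hC N hN)
    (hKΛ N hN) fun j hj => by
      by_contra h0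
      have := Finset.mem_range.1 (hT (Finsupp.mem_support_iff.2 h0))
      omega
  -- The coordinate `w` does not enter the network, so it is set to `0`.
  refine ⟨(0, α, θ 0, b + β), ?_, fun z hz => ?_⟩
  · have hbβ : |b + β| ≤ |b| + Q := (abs_add_le _ _).trans (by linarith)
    refine Real.sqrt_le_iff.2 ⟨by positivity, ?_⟩
    have h1 : ‖α‖ ^ 2 ≤ Q ^ 2 := by gcongr
    have h2 : (b + β) ^ 2 ≤ (|b| + Q) ^ 2 := by
      rw [← sq_abs (b + β)]
      gcongr
    have h3 : 0 ≤ Q * ‖θ 0‖ := by positivity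
    have h4 : 0 ≤ (Q + ‖θ 0‖) * (|b| + Q) := by positivity
    simp only
    nlinarith
  · have h1 := hσ.dist_le_mul
      (inner ℝ α (state id (A N) (B N) (C N) z 1) + inner ℝ (θ 0) (z 0) + (b + β))
      (pastForm θ z + b)
    rw [Real.dist_eq, Real.dist_eq] at h1
    refine h1.trans (le_trans ?_ hNη.le)
    gcongr
    refine (le_of_eq ?_).trans (h z hz)
    congr 1
    ring

theorem lintegral_enorm_sq {α : Type*} [MeasurableSpace α] (μ : Measure α) (f : α → ℝ) :
    ∫⁻ x, ‖f x‖ₑ ^ 2 ∂μ = eLpNorm f 2 μ ^ 2 := by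
  have := eLpNorm_nnreal_pow_eq_lintegral (f := f) (μ := μ) (p := 2) (by norm_num)
  simpa using this.symm

theorem enorm_sub_sq_le {x y y' η : ℝ} (h : |y - y'| ≤ η) :
    ‖x - y‖ₑ ^ 2 ≤ 2 * ‖x - y'‖ₑ ^ 2 + ENNReal.ofReal (2 * η ^ 2) := by
  have hsq (t : ℝ) : ‖t‖ₑ ^ 2 = ENNReal.ofReal (t ^ 2) := by
    rw [Real.enorm_eq_ofReal_abs, ← ENNReal.ofReal_pow (abs_nonneg t), sq_abs]
  rw [hsq, hsq, ← ENNReal.ofReal_ofNat 2, ← ENNReal.ofReal_mul (by norm_num),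
    ← ENNReal.ofReal_add (by positivity) (by positivity)]
  refine ENNReal.ofReal_le_ofReal ?_
  have h2 : (y - y') ^ 2 ≤ η ^ 2 := sq_le_sq' (by linarith [(abs_le.1 h).1]) (abs_le.1 h).2
  nlinarith [sq_nonneg ((x - y') + (y - y'))]

end Approximation

end ESN

end

/-! ### Choice of the constants and assembly of the error estimate. -/

theorem mainTheorem3 {d : ℕ} [NeZero d]
    (D : Set (ESN.Vec d)) (hD : Bornology.IsBounded D)
    (I : Set (ESN.PastSeq d)) (hI : ∀ z ∈ I, ∀ k, z k ∈ D)
    (σ₂ : ℝ → ℝ)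
    (hσ₂ : (σ₂ = fun x => max x 0) ∨
      ((∃ R : ℝ, ∀ x, |σ₂ x| ≤ R) ∧ (∃ L : ℝ≥0, LipschitzWith L σ₂) ∧ ∃ x y, σ₂ x ≠ σ₂ y))
    (A : (N : ℕ) → Matrix (Fin N) (Fin N) ℝ)
    (B : (N : ℕ) → ESN.Vec N)
    (C : (N : ℕ) → Matrix (Fin N) (Fin d) ℝ)
    (c l₀ l₁ : ℝ) (hc : 0 < c) (hl₀ : 0 < l₀) (hl : l₀ < l₁) (hl₁ : l₁ < 1)
    (hK : ∀ N, 1 ≤ N → IsUnit (ESN.controllability (A N) (C N)))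
    (hA : ∀ N, 1 ≤ N → l₀ < ‖A N‖ ∧ ‖A N‖ < l₁)
    (hB : ∀ N, 1 ≤ N → ‖B N‖ ≤ c)
    (hC : ∀ N, 1 ≤ N → ‖C N‖ ≤ c)
    (hKΛ : ∀ N, 1 ≤ N →
      ‖((ESN.controllability (A N) (C N))⁻¹).transpose * ESN.decay N d l₀‖ ≤ c)
    (ν₀ : (N : ℕ) → Measure (ESN.Weights N d)) [∀ N, IsProbabilityMeasure (ν₀ N)]
    (hν₀ : ∃ m : ℝ≥0, ∀ N, 1 ≤ N → ESN.firstMoment (ν₀ N) ≤ m)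
    (H : I → ℝ) (γ : Measure I) [IsProbabilityMeasure γ] (hH : MemLp H 2 γ)
    (ε : ℝ) (hε : 0 < ε) :
    ∃ N₀ : ℕ, ∀ N, N₀ ≤ N →
      (∀ z ∈ I, ∃! x, ESN.IsBoundedSolution id (A N) (B N) (C N) z x) ∧
      ∃ ν : Measure (ESN.Weights N d), IsProbabilityMeasure ν ∧
        ESN.wasserstein1 (ν₀ N) ν < ENNReal.ofReal ε ∧
        ∃ W : (Fin N → ESN.Weights N d) → (Fin N → ℝ), Measurable W ∧
          (∫⁻ z, ∫⁻ ξ, ‖H z - ESN.esnElm id σ₂ (A N) (B N) (C N) (W ξ) ξ z‖ₑ ^ 2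
            ∂(Measure.pi fun _ : Fin N => ν) ∂γ) ^ (1 / 2 : ℝ) < ENNReal.ofReal ε := by
  obtain ⟨R, hR0, hDR⟩ := hD.exists_pos_norm_le
  have hR : ∀ z ∈ I, ∀ k, ‖z k‖ ≤ R := fun z hz k => hDR _ (hI z hz k)
  obtain ⟨m, hm⟩ := hν₀
  have hσ : ESN.IsActivation σ₂ := hσ₂
  obtain ⟨L, hL⟩ := hσ.lipschitz
  -- Budget for the squared error: `2(ε/4)²` from density, `2(ε/4)²` from replacing past inputs by
  -- the state, `ε²/4` from missed neurons; in total `ε²/2`.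
  obtain ⟨f, hGmem, hGε⟩ := ESN.exists_network_approx (e := ENNReal.ofReal (ε / 4)) hσ hR hH
    (by simpa using hε)
  set G : I → ℝ := fun z => f.sum fun q v => v * σ₂ (ESN.pastForm q.1 z + q.2) with hG
  choose P hP0 hP using ESN.eventually_exists_weights hR0.le hL (A := A) (B := B) (C := C) hc hl₀
    (hl₀.trans hl).le hl₁ hK (fun N hN => (hA N hN).2.le) hB hC hKΛ
  -- The index set is enlarged by one point to make it nonempty.
  classical
  let s : Finset ((ℕ →₀ ESN.Vec d) × ℝ) := insert (0, 0) f.support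
  have : Nonempty s := ⟨⟨(0, 0), Finset.mem_insert_self _ _⟩⟩
  have hGs : ∀ z : I, G z = ∑ q : s, f q * σ₂ (ESN.pastForm q.1.1 z + q.1.2) := fun z => by
    rw [hG, Finset.sum_coe_sort s fun q => f q * σ₂ (ESN.pastForm q.1 z + q.2)]
    exact Finsupp.sum_of_support_subset _ (Finset.subset_insert _ _) _ (by simp)
  let V : ℝ := ∑ q : s, |f q|
  have hV0 : 0 ≤ V := Finset.sum_nonneg fun _ _ => abs_nonneg _
  -- The `+ 1` covers the case `V = 0`.
  let η : ℝ := ε / 4 / (V + 1)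
  have hη : 0 < η := by positivity
  have hVη : V * η ≤ ε / 4 := by
    rw [show V * η = ε / 4 * (V / (V + 1)) by simp only [η]; ring]
    exact mul_le_of_le_one_right (by positivity) ((div_le_one (by positivity)).2 (by linarith))
  let P' : ℝ := ∑ q : s, P q
  have hP'0 : 0 ≤ P' := Finset.sum_nonneg fun _ _ => hP0 _
  have hPP' : ∀ q : s, P q ≤ P' := fun q =>
    Finset.single_le_sum (f := fun q : s => P q) (fun _ _ => hP0 _) (Finset.mem_univ q)
  -- The fraction of mass that is moved.
  let δ : ℝ := min (1 / 2) (ε / (4 * (m + P') + 4))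
  have hδ0 : 0 < δ := lt_min (by norm_num) (by positivity)
  have hδ1 : δ ≤ 1 / 2 := min_le_left _ _
  have hδε : δ * (2 * (m + P')) < ε := by
    have h1 : δ ≤ ε / (4 * (m + P') + 4) := min_le_right _ _
    rw [le_div_iff₀ (by positivity)] at h1
    have h2 : 0 ≤ δ * (m + P') := by positivity
    linarith
  -- A lower bound for the mass of each atom of `ν`. Neither `δ` nor the number of neurons depends
  -- on `N`, so `(1 - b) ^ N → 0`.
  let b : ℝ≥0∞ := ENNReal.ofReal δ * (Fintype.card s : ℝ≥0∞)⁻¹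
  have hHtop : ∫⁻ z, ‖H z‖ₑ ^ 2 ∂γ ≠ ∞ := by
    rw [ESN.lintegral_enorm_sq]
    exact ENNReal.pow_ne_top hH.2.ne
  have hmiss : Filter.Tendsto (fun N : ℕ => (Fintype.card s : ℝ≥0∞) * (1 - b) ^ N *
      ∫⁻ z, ‖H z‖ₑ ^ 2 ∂γ) Filter.atTop (nhds 0) := by
    have hb : b ≠ 0 := mul_ne_zero (by simpa using hδ0) (by simp)
    have h1 : 1 - b < 1 := ENNReal.sub_lt_self (by simp) (by simp) hb
    have h2 := ENNReal.Tendsto.const_mul (a := (Fintype.card s : ℝ≥0∞))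
      (ENNReal.tendsto_pow_atTop_nhds_zero_of_lt_one h1) (Or.inr (by simp))
    have h3 := ENNReal.Tendsto.mul_const (b := ∫⁻ z, ‖H z‖ₑ ^ 2 ∂γ) h2 (Or.inr hHtop)
    simpa using h3
  have hev : ∀ᶠ N in Filter.atTop, ∀ q : s, ∃ x : ESN.Weights N d, ESN.weightNorm x ≤ P q ∧
      ∀ z : ESN.PastSeq d, (∀ k, ‖z k‖ ≤ R) →
        |σ₂ (inner ℝ x.2.1 (ESN.state id (A N) (B N) (C N) z 1) + inner ℝ x.2.2.1 (z 0) + x.2.2.2) -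
          σ₂ (ESN.pastForm q.1.1 z + q.1.2)| ≤ η :=
    Filter.eventually_all.2 fun q => hP q η hη
  refine Filter.eventually_atTop.1 ?_
  filter_upwards [hev, hmiss.eventually_lt_const (ENNReal.ofReal_pos.2
    (show 0 < ε ^ 2 / 4 by positivity)), Filter.eventually_ge_atTop 1] with N hN hNmiss hN1
  refine ⟨fun z hz => ESN.existsUnique_isBoundedSolution ((hA N hN1).2.trans hl₁) (hR z hz), ?_⟩
  choose p hpP hp using hN
  have hδsum : ENNReal.ofReal (1 - δ) + ENNReal.ofReal δ = 1 := by
    rw [← ENNReal.ofReal_add (by linarith) hδ0.le]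
    simp
  let ν : Measure (ESN.Weights N d) :=
    ENNReal.ofReal (1 - δ) • ν₀ N + ENNReal.ofReal δ • ESN.empirical p
  have hν : IsProbabilityMeasure ν := ⟨by simp [ν, hδsum]⟩
  refine ⟨ν, hν, ?_, ESN.sampleReadout p fun q => f q, ESN.measurable_sampleReadout _ _, ?_⟩
  · refine (ESN.wasserstein1_mixture_le _ _ hδsum).trans_lt ?_
    have h1 : ESN.firstMoment (ESN.empirical p) ≤ ENNReal.ofReal P' :=
      ESN.lintegral_empirical_le p ESN.measurable_weightNorm.ennreal_ofReal fun q =>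
        ENNReal.ofReal_le_ofReal ((hpP q).trans (hPP' q))
    calc ENNReal.ofReal δ * (2 * (ESN.firstMoment (ν₀ N) + ESN.firstMoment (ESN.empirical p)))
        ≤ ENNReal.ofReal δ * (2 * (ENNReal.ofReal m + ENNReal.ofReal P')) := by
          gcongr
          simpa using hm N hN1
      _ = ENNReal.ofReal (δ * (2 * (m + P'))) := by
          rw [← ENNReal.ofReal_add (by positivity) hP'0, ← ENNReal.ofReal_ofNat 2,
            ← ENNReal.ofReal_mul (by norm_num), ← ENNReal.ofReal_mul hδ0.le]
      _ < ENNReal.ofReal ε := (ENNReal.ofReal_lt_ofReal_iff hε).2 hδε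
  · let F : I → ESN.Weights N d → ℝ := fun z x =>
      σ₂ (inner ℝ x.2.1 (ESN.state id (A N) (B N) (C N) z 1) + inner ℝ x.2.2.1 (z.1 0) + x.2.2.2)
    have hbν : ∀ q, b ≤ ν {p q} := fun q => by
      have := ESN.inv_card_le_empirical p q
      simp only [ν, b, Measure.add_apply, Measure.smul_apply, smul_eq_mul]
      exact le_add_left (by gcongr)
    have hprob := ESN.pi_compl_hitAll_le (N := N) ν p hbν
    have hclose : ∀ z : I, |∑ q : s, f q * F z (p q) - G z| ≤ ε / 4 := by
      intro z
      rw [hGs, ← Finset.sum_sub_distrib]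
      refine (Finset.abs_sum_le_sum_abs _ _).trans (le_trans ?_ hVη)
      rw [Finset.sum_mul]
      refine Finset.sum_le_sum fun q _ => ?_
      rw [← mul_sub, abs_mul]
      gcongr
      exact hp q z (hR z z.2)
    have hpt : ∀ z : I, ∫⁻ ξ, ‖H z - ESN.esnElm id σ₂ (A N) (B N) (C N)
          (ESN.sampleReadout p (fun q => f q) ξ) ξ z‖ₑ ^ 2 ∂(Measure.pi fun _ : Fin N => ν) ≤
        2 * ‖(H - G) z‖ₑ ^ 2 + (ENNReal.ofReal (2 * (ε / 4) ^ 2) +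
          Fintype.card s * (1 - b) ^ N * ‖H z‖ₑ ^ 2) := by
      intro z
      refine (ESN.lintegral_sampleReadout_le ν p (fun q => f q) (F z) (H z)).trans ?_
      rw [← add_assoc]
      exact add_le_add (ESN.enorm_sub_sq_le (hclose z)) (by gcongr)
    have hHG : AEMeasurable (fun z => 2 * ‖(H - G) z‖ₑ ^ 2) γ :=
      ((hH.1.sub hGmem.1).enorm.pow_const 2).const_mul 2
    have hHm : AEMeasurable (fun z => ‖H z‖ₑ ^ 2) γ := hH.1.enorm.pow_const 2
    have hE : ∫⁻ z, ‖(H - G) z‖ₑ ^ 2 ∂γ ≤ ENNReal.ofReal ((ε / 4) ^ 2) := by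
      rw [ESN.lintegral_enorm_sq, ENNReal.ofReal_pow (by positivity)]
      exact pow_le_pow_left₀ zero_le hGε.le 2
    have htotal : ∫⁻ z, ∫⁻ ξ, ‖H z - ESN.esnElm id σ₂ (A N) (B N) (C N)
          (ESN.sampleReadout p (fun q => f q) ξ) ξ z‖ₑ ^ 2 ∂(Measure.pi fun _ : Fin N => ν) ∂γ <
        ENNReal.ofReal ε ^ 2 := by
      refine (lintegral_mono hpt).trans_lt ?_
      rw [lintegral_add_left' hHG, lintegral_add_left measurable_const,
        lintegral_const_mul'' _ ((hH.1.sub hGmem.1).enorm.pow_const 2),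
        lintegral_const_mul'' _ hHm, lintegral_const, measure_univ, mul_one]
      calc _ ≤ 2 * ENNReal.ofReal ((ε / 4) ^ 2) +
            (ENNReal.ofReal (2 * (ε / 4) ^ 2) + ENNReal.ofReal (ε ^ 2 / 4)) := by gcongr
        _ = ENNReal.ofReal (ε ^ 2 / 2) := by
            rw [← ENNReal.ofReal_ofNat 2, ← ENNReal.ofReal_mul (by norm_num),
              ← ENNReal.ofReal_add (by positivity) (by positivity),
              ← ENNReal.ofReal_add (by positivity) (by positivity)]
            congr 1
            ring
        _ < ENNReal.ofReal (ε ^ 2) := by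
            refine (ENNReal.ofReal_lt_ofReal_iff (by positivity)).2 ?_
            have : 0 < ε ^ 2 := by positivity
            linarith
        _ = ENNReal.ofReal ε ^ 2 := ENNReal.ofReal_pow hε.le 2
    have := ENNReal.rpow_lt_rpow htotal (show (0 : ℝ) < 1 / 2 by norm_num)
    rwa [← ENNReal.rpow_natCast, ← ENNReal.rpow_mul,
      show ((2 : ℕ) : ℝ) * (1 / 2) = 1 by norm_num, ENNReal.rpow_one] at this
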